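/- For complex numbers $x,p$ and an integer $k\ge 0$ let $(x;p)_k=\prod_{r=0}^{k-1}(1-xp^r)$ and $$\left[\begin{matrix}x_1,\dots,x_s\\ y_1,\dots,y_t\end{matrix};p\right]_k=\frac{(x_1;p)_k\cdots(x_s;p)_k}{(y_1;p)_k\cdots(y_t;p)_k},\qquad {}_4\phi_3\left[\begin{matrix}a_0,a_1,a_2,a_3\\ b_1,b_2,b_3\end{matrix};q;z\right]=\sum_{k=0}^{\infty}\left[\begin{matrix}a_0,a_1,a_2,a_3\\ q,b_1,b_2,b_3\end{matrix};q\right]_k z^k ,$$ and let $\chi(k)=\{1+(-1)^k\}/2$ for every integer $k$. **Theorem 5.** Let $q,a,c$ be nonzero complex numbers and let $n,\ell,m$ be nonnegative integers, such that no denominator below vanishes (for the series on the left only the terms $k\le n$ matter, the other ones being $0$; for the double sum only the terms with $i+j\le n$ and $n-i-j$ even matter). Then $$\begin{aligned} &{}_4\phi_3\left[\begin{matrix}q^{-n},\,a,\,c,\,-q^{1+\ell-m-n}/ac\\ q^{1+\ell-n}/a,\,q^{1-m-n}/c,\,-ac\end{matrix};q;q\right] =\left[\begin{matrix}q^{1+\ell-n}/a^2,\,-q/a\\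 q^{1+\ell}/a^2,\,-q^{1-n}/a\end{matrix};q\right]_{\ell} \left[\begin{matrix}-a,\,q^{m}c^2\\ -ac,\,q^{m}c\end{matrix};q\right]_{n}\\ &\quad\times\sum_{i=0}^{\ell}\sum_{j=0}^{m}(-1)^{i}q^{ni+(m+n-i)j-\binom{j}{2}}a^ic^{n-i}\, \frac{1-q^{2i-2\ell-1}a^2}{1-q^{-2\ell-1}a^2} \left[\begin{matrix}q^{-\ell},\,q^{-n},\,q^{-2\ell-1}a^2\\ q,\,q^{n-2\ell}a^2,\,q^{-\ell}a^2\end{matrix};q\right]_i\\ &\quad\times\left[\begin{matrix}q^{-m},\,q^{i-n},\,q^{1+2\ell-n-i}/a^2,\,c,\,-c\\ q,\,q^{1+\ell-n}/a,\,-q^{1+\ell-n}/a,\,q^{m}c^2,\,q^{j-1}c^2\end{matrix};q\right]_j \left[\begin{matrix}q,\,q^{2+2\ell-2n}/a^2c^2\\ q^{2+2\ell-2n+2j}/a^2,\,q^{1+2j}c^2\end{matrix};q^2\right]_{\frac{n-i-j}{2}}\chi(n-i-j), \end{aligned}$$ where a term of the double sum is $0$ if $n-i-j$ is odd or negative (in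 the latter case because of the factor $(q^{-n};q)_i\,(q^{i-n};q)_j$). -/

import Mathlib

open Finset

/-- The `q`-shifted factorial `(x; q)_n = ∏_{k=0}^{n-1} (1 - x q^k)`. -/
noncomputable def qPoch (x q : ℂ) (n : ℕ) : ℂ :=
  ∏ k ∈ range n, (1 - x * q ^ k)

/-- The fraction form
`(a; q)_n (b; q)_n ⋯ / ((α; q)_n (β; q)_n ⋯)` of the `q`-shifted factorial. -/
noncomputable def qFrac (q : ℂ) (num den : List ℂ) (n : ℕ) : ℂ :=
  (num.map fun x => qPoch x q n).prod / (den.map fun x => qPoch x q n).prod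

/-- No zero factor occurs in the denominator `(α; q)_n (β; q)_n ⋯`. -/
def qDenNonzero (q : ℂ) (den : List ℂ) (n : ℕ) : Prop :=
  ∀ x ∈ den, qPoch x q n ≠ 0

/-- The `k`-th summand of the basic hypergeometric series with numerator parameters `as` and
denominator parameters `bs` (the factor `(q; q)_k` is added to the denominator). -/
noncomputable def basicHypTerm (q z : ℂ) (as bs : List ℂ) (k : ℕ) : ℂ :=
  qFrac q as (q :: bs) k * z ^ k

/-- The basic hypergeometric series `φ(as; bs; q, z)`, summed over all `k ≥ 0`. -/
noncomputable def basicHyp (q z : ℂ) (as bs : List ℂ) : ℂ :=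
  ∑' k : ℕ, basicHypTerm q z as bs k

/-- The parity factor `χ(k) = (1 + (-1)^k) / 2`. -/
noncomputable def chi (k : ℤ) : ℂ := (1 + (-1) ^ k) / 2

/-!
The double sum arises from three classical facts, all of which are proved here in convolution form,
as sums over `r + k = n`, so that no parameter `q^{-n}` is needed.

Put `v = a q^{-ℓ}`. Reversing factors, the series on the left becomes a convolution. Sears'
transformation of terminating balanced `₄φ₃` series (`qSears`, two applications of the
`q`-Pfaff–Saalschütz sum `qSaalschutz`) turns it, up to an explicit factor, into
`∑_{r+k=n} (-1)^k P_r(v, ℓ) P_k(c, m)`, where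
`P_r(x, m) = (x)_r (-x q^m)_r / ((q)_r (x² q^m)_r)` (`series_transform`). The two shifts `ℓ` and `m`
now play the same role. A terminating very-well-poised sum (`qVWP_sum`) expands `P_r(x, m)` into the
coefficients `p_{r-i}(x² q^{2i})`, `i ≤ m`, where
`p_s(α) = (α; q²)_s / ((q)_s (α)_s)` (`shift_expansion`). The two expansions give the sums over `i`
and `j`, and the remaining convolutions `∑_{r+k=N} (-1)^k p_r(α) p_k(γ)` are evaluated by Andrews'
`q`-Watson sum (`qWatson_even`, `qWatson_odd`), which produces the parity factor and the last
quotient in base `q²`.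

The summation formulas follow from recurrences in `n`: the factor in front of the sum is written as
a combination of expressions each of which lowers one of the two indices by one.

The intermediate steps divide by quantities that may vanish under the hypotheses of the theorem.
They are therefore carried out for `q` not a root of unity and `a²`, `c²`, `a²c²` not integral
powers of `q`. Such parameters are dense (`generic_mem_closure`), and both sides are continuous
where the stated denominators do not vanish.
-/

open Filter Topology

/-! ### Shifted factorials -/

@[simp] theorem qPoch_zero (x q : ℂ) : qPoch x q 0 = 1 := by simp [qPoch]

theorem qPoch_succ (x q : ℂ) (n : ℕ) :
    qPoch x q (n + 1) = qPoch x q n * (1 - x * q ^ n) := by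
  simp [qPoch, prod_range_succ]

theorem qPoch_add (x q : ℂ) (m n : ℕ) :
    qPoch x q (m + n) = qPoch x q m * qPoch (x * q ^ m) q n := by
  simp only [qPoch, prod_range_add, pow_add, mul_assoc]

theorem qPoch_sq (x q : ℂ) (n : ℕ) :
    qPoch (x ^ 2) (q ^ 2) n = qPoch x q n * qPoch (-x) q n := by
  simp only [qPoch, ← prod_mul_distrib]
  refine prod_congr rfl fun k _ => ?_
  ring

theorem qPoch_ne_zero {x q : ℂ} (h : ∀ k : ℕ, 1 - x * q ^ k ≠ 0) (n : ℕ) : qPoch x q n ≠ 0 :=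
  prod_ne_zero_iff.2 fun k _ => h k

/-- `(q^{-m}; q)_n = 0` for `m < n`. -/
theorem qPoch_zpow_neg_eq_zero {q : ℂ} (hq : q ≠ 0) {m n : ℕ} (h : m < n) :
    qPoch (q ^ (-m : ℤ)) q n = 0 := by
  refine prod_eq_zero (mem_range.2 h) ?_
  rw [zpow_neg, zpow_natCast, inv_mul_cancel₀ (pow_ne_zero _ hq), sub_self]

/-- Reversal of the order of the factors: `(q^{1-n}/x; q)_k` for `n = r + k`. -/
theorem qPoch_reverse {q x : ℂ} (hq : q ≠ 0) (hx : x ≠ 0) (r k : ℕ) :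
    qPoch (q ^ (1 - (r + k : ℕ) : ℤ) / x) q k * qPoch x q r * x ^ k * q ^ (r * k + k.choose 2) =
      (-1) ^ k * qPoch x q (r + k) := by
  induction k generalizing r with
  | zero => simp
  | succ k ih =>
    have h := ih (r + 1)
    rw [show r + 1 + k = r + (k + 1) by ring] at h
    rw [qPoch_succ, pow_succ (-1 : ℂ), mul_right_comm ((-1 : ℂ) ^ k), ← h, qPoch_succ x q r,
      Nat.choose_succ_succ' k 1, Nat.choose_one_right]
    have e : q ^ (1 - (r + (k + 1) : ℕ) : ℤ) / x * q ^ k = (x * q ^ r)⁻¹ := by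
      rw [mul_inv, div_eq_mul_inv, mul_right_comm, ← zpow_natCast, ← zpow_natCast, ← zpow_add₀ hq,
        ← zpow_neg, mul_comm]
      congr 2
      push_cast; ring
    rw [e]
    have hy : x * q ^ r ≠ 0 := mul_ne_zero hx (pow_ne_zero _ hq)
    field_simp
    ring

/-! ### The `q`-Pfaff–Saalschütz sum -/

/-- The `q`-Pfaff–Saalschütz sum, with the parameters `q^{-n}` and `q^{1-n}/w` of the usual form
absorbed into the factor `(w; q)_r / (q; q)_r`, `r + k = n`. -/
theorem qSaalschutz {q w x y D : ℂ} (hq : ∀ k : ℕ, 1 - q * q ^ k ≠ 0)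
    (hD : ∀ k : ℕ, 1 - D * q ^ k ≠ 0) (hq0 : q ≠ 0) (hw : D = w * x * y) (n : ℕ) :
    ∑ p ∈ antidiagonal n, qPoch w q p.1 / qPoch q q p.1 *
        (qPoch x q p.2 * qPoch y q p.2 * w ^ p.2 / (qPoch q q p.2 * qPoch D q p.2)) =
      qPoch (w * x) q n * qPoch (w * y) q n / (qPoch q q n * qPoch D q n) := by
  set A : ℕ → ℂ := fun i => qPoch w q i / qPoch q q i with hA
  set B : ℕ → ℂ := fun k => qPoch x q k * qPoch y q k * w ^ k /
    (qPoch q q k * qPoch D q k) with hB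
  have nq := qPoch_ne_zero hq
  have nD := qPoch_ne_zero hD
  have hA' (i : ℕ) : (1 - q * q ^ i) * A (i + 1) = (1 - w * q ^ i) * A i := by
    have := nq i; have := hq i
    simp only [hA, qPoch_succ]; field_simp
  have hB' (k : ℕ) : (1 - q * q ^ k) * (1 - D * q ^ k) * B (k + 1) =
      w * (1 - x * q ^ k) * (1 - y * q ^ k) * B k := by
    have := nq k; have := hq k; have := nD k; have := hD k
    simp only [hB, qPoch_succ]
    generalize 1 - D * q ^ k = s at *
    field_simp; ring
  have step (n : ℕ) : (1 - q * q ^ n) * (1 - D * q ^ n) *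
      ∑ p ∈ antidiagonal (n + 1), A p.1 * B p.2 =
      (1 - w * x * q ^ n) * (1 - w * y * q ^ n) * ∑ p ∈ antidiagonal n, A p.1 * B p.2 := by
    -- The two parts vanish at `p.1 = 0` and at `p.2 = 0`, and lower the respective index.
    have key : (1 - q * q ^ n) * (1 - D * q ^ n) *
        ∑ p ∈ antidiagonal (n + 1), A p.1 * B p.2 =
        ∑ p ∈ antidiagonal (n + 1),
          (1 - D * q ^ n * q ^ p.2) * ((1 - q ^ p.1) * A p.1) * B p.2 +
        ∑ p ∈ antidiagonal (n + 1),
          q ^ p.1 * A p.1 * ((1 - q ^ p.2) * (1 - D / q * q ^ p.2) * B p.2) := by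
      rw [mul_sum, ← sum_add_distrib]
      refine sum_congr rfl fun p hp => ?_
      have e : q ^ p.1 * q ^ p.2 = q * q ^ n := by
        rw [← pow_add, mem_antidiagonal.1 hp, pow_succ']
      have e2 : q ^ n = q ^ p.1 * q ^ p.2 / q := by rw [e]; field_simp
      rw [e2]; field_simp; ring
    rw [key, Nat.sum_antidiagonal_succ, Nat.sum_antidiagonal_succ' (f := fun p : ℕ × ℕ =>
      q ^ p.1 * A p.1 * ((1 - q ^ p.2) * (1 - D / q * q ^ p.2) * B p.2))]
    simp only [pow_zero, sub_self, zero_mul, mul_zero, zero_add]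
    rw [← sum_add_distrib, mul_sum]
    refine sum_congr rfl fun p hp => ?_
    have e : q ^ n = q ^ p.1 * q ^ p.2 := by rw [← pow_add, mem_antidiagonal.1 hp]
    have h1 := hA' p.1
    have h2 : (1 - q ^ (p.2 + 1)) * (1 - D / q * q ^ (p.2 + 1)) * B (p.2 + 1) =
      w * (1 - x * q ^ p.2) * (1 - y * q ^ p.2) * B p.2 := by
      rw [← hB' p.2, pow_succ']; field_simp
    rw [h2, pow_succ' q p.1, h1, e, hw]; ring
  induction n with
  | zero => simp
  | succ n ih =>
    have h := step n
    have := nq n; have := hq n; have := nD n; have := hD n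
    rw [ih] at h
    rw [qPoch_succ (w * x), qPoch_succ (w * y), qPoch_succ q, qPoch_succ D,
      eq_div_iff (by positivity)]
    field_simp at h
    linear_combination h

/-! ### A terminating very-well-poised sum -/

/-- A terminating very-well-poised `₆φ₅` sum with base `A`, in the special case where one of the
numerator parameters is a square root `d` of `A q`; here `β = d / b`. -/
theorem qVWP_sum {q A b d e β : ℂ} (hq0 : q ≠ 0) (hq : ∀ k : ℕ, 1 - q * q ^ k ≠ 0)
    (hA : A * q = d ^ 2) (hb : b * β = d) (he : e = d * β)
    (hd2 : ∀ k : ℕ, 1 - d ^ 2 * q ^ k ≠ 0) (hd : ∀ k : ℕ, 1 - d * q ^ k ≠ 0)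
    (hdβ : ∀ k : ℕ, 1 - e * q ^ k ≠ 0) (N : ℕ) :
    ∑ p ∈ antidiagonal N, (1 - A * q ^ (2 * p.1)) *
        (qPoch A q p.1 * qPoch b q p.1 * (-β) ^ p.1 * q ^ p.1.choose 2 /
          (qPoch q q p.1 * qPoch e q p.1) /
          (qPoch q q p.2 * qPoch (d ^ 2) q (2 * p.1 + p.2))) =
      (1 - A) * qPoch β q N / (qPoch q q N * qPoch e q N * qPoch d q N) := by
  set U : ℕ → ℕ → ℂ := fun i j => qPoch A q i * qPoch b q i * (-β) ^ i * q ^ i.choose 2 /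
          (qPoch q q i * qPoch e q i) /
          (qPoch q q j * qPoch (d ^ 2) q (2 * i + j)) with hU
  have nq := qPoch_ne_zero hq
  have nd := qPoch_ne_zero hd
  have nd2 := qPoch_ne_zero hd2
  have ndβ := qPoch_ne_zero hdβ
  have hUj (i j : ℕ) : (1 - q * q ^ j) * (1 - d ^ 2 * q ^ (2 * i + j)) * U i (j + 1) = U i j := by
    have := nq i; have := nq j; have := hq j; have := ndβ i; have := nd2 (2 * i + j)
    have := hd2 (2 * i + j)
    simp only [hU, ← add_assoc, qPoch_succ]; field_simp
  have hUi (i j : ℕ) : (1 - q * q ^ i) * (1 - e * q ^ i) *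
      (1 - d ^ 2 * q ^ (2 * i + j + 1)) * U (i + 1) j =
      -(1 - A * q ^ i) * (1 - b * q ^ i) * q ^ i * β * (1 - q * q ^ j) * U i (j + 1) := by
    have := nq i; have := nq j; have := hq j; have := hq i; have := ndβ i; have := hdβ i
    have := nd2 (2 * i + j)
    have := hd2 (2 * i + j); have := hd2 (2 * i + j + 1)
    simp only [hU, show 2 * (i + 1) + j = 2 * i + j + 1 + 1 by ring, ← add_assoc, qPoch_succ,
      Nat.choose_succ_succ' i 1, Nat.choose_one_right, pow_succ (-β), pow_add q i (i.choose _)]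
    generalize 1 - e * q ^ i = s at *
    field_simp
  have step (N : ℕ) : (1 - q * q ^ N) * (1 - e * q ^ N) * (1 - d * q ^ N) *
      ∑ p ∈ antidiagonal (N + 1), (1 - A * q ^ (2 * p.1)) * U p.1 p.2 =
      (1 - β * q ^ N) * ∑ p ∈ antidiagonal N, (1 - A * q ^ (2 * p.1)) * U p.1 p.2 := by
    have h1 : ∑ p ∈ antidiagonal N, (1 - A * q ^ (2 * p.1)) * U p.1 p.2 =
        ∑ p ∈ antidiagonal (N + 1), (1 - A * q ^ (2 * p.1)) *
          ((1 - q ^ p.2) * (1 - d ^ 2 * (q ^ N * q ^ p.1)) * U p.1 p.2) := by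
      rw [Nat.sum_antidiagonal_succ']
      simp only [pow_zero, sub_self, zero_mul, mul_zero, zero_add]
      refine sum_congr rfl fun p hp => ?_
      rw [← hUj, ← mem_antidiagonal.1 hp]
      ring
    -- The telescoping pair: the left side at `(i, j + 1)` is the right side at `(i + 1, j)`.
    have h2 : ∑ p ∈ antidiagonal (N + 1),
          (d * q ^ N - q ^ p.2 / q) *
          (-(1 - A * q ^ p.1) * (1 - b * q ^ p.1) * q ^ p.1 * β * ((1 - q ^ p.2) * U p.1 p.2)) =
        ∑ p ∈ antidiagonal (N + 1),
          (d * q ^ N - q ^ p.2) *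
          ((1 - q ^ p.1) * (1 - e * q ^ p.1 / q) * (1 - d ^ 2 * (q ^ N * q ^ p.1)) *
            U p.1 p.2) := by
      rw [Nat.sum_antidiagonal_succ', Nat.sum_antidiagonal_succ]
      simp only [pow_zero, sub_self, zero_mul, mul_zero, zero_add]
      refine sum_congr rfl fun p hp => ?_
      have h := hUi p.1 p.2
      have e0 : q ^ N * q ^ (p.1 + 1) = q ^ (2 * p.1 + p.2 + 1) := by
        rw [← mem_antidiagonal.1 hp]; ring
      have e1 : e * q ^ (p.1 + 1) / q = e * q ^ p.1 := by rw [pow_succ]; field_simp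
      have e2 : q ^ (p.2 + 1) / q = q ^ p.2 := by rw [pow_succ]; field_simp
      rw [e0, e1, e2, pow_succ' q p.1, h, pow_succ' q p.2]
      ring
    rw [h1, ← sub_eq_zero, mul_sum, mul_sum, ← sum_sub_distrib, ← sub_eq_zero.2 h2,
      ← sum_sub_distrib]
    refine sum_congr rfl fun p hp => ?_
    have e0 : q ^ p.1 * q ^ p.2 = q * q ^ N := by
      rw [← pow_add, mem_antidiagonal.1 hp, pow_succ']
    have e2 : q ^ N = q ^ p.1 * q ^ p.2 / q := by rw [e0]; field_simp
    have e3 : A = d ^ 2 / q := by rw [← hA]; field_simp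
    rw [e2, e3, he, ← hb]; field_simp; ring
  change ∑ p ∈ antidiagonal N, (1 - A * q ^ (2 * p.1)) * U p.1 p.2 = _
  induction N with
  | zero => simp [hU]
  | succ N ih =>
    have h := step N
    have := nq N; have := hq N; have := nd N; have := hd N; have := ndβ N; have := hdβ N
    rw [ih] at h
    rw [qPoch_succ β, qPoch_succ q, qPoch_succ e, qPoch_succ d,
      eq_div_iff (by positivity)]
    field_simp at h
    linear_combination h

/-! ### Sears' transformation -/

theorem sum_antidiagonal_antidiagonal_assoc {M : Type*} [AddCommMonoid M] (f : ℕ → ℕ → ℕ → M)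
    (n : ℕ) :
    ∑ p ∈ antidiagonal n, ∑ t ∈ antidiagonal p.2, f p.1 t.1 t.2 =
      ∑ p ∈ antidiagonal n, ∑ t ∈ antidiagonal p.1, f t.1 t.2 p.2 := by
  rw [sum_sigma', sum_sigma']
  refine sum_nbij' (fun s => ⟨(s.1.1 + s.2.1, s.2.2), (s.1.1, s.2.1)⟩)
    (fun s => ⟨(s.2.1, s.2.2 + s.1.2), (s.2.2, s.1.2)⟩) ?_ ?_ ?_ ?_ ?_ <;>
  · rintro ⟨⟨a, b⟩, ⟨c, d⟩⟩ h
    simp only [mem_sigma, HasAntidiagonal.mem_antidiagonal] at h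
    obtain ⟨rfl, rfl⟩ := h
    simp [add_assoc]

/-- Sears' transformation of terminating balanced `₄φ₃` series, with the parameters `q^{-n}` and
`q^{1-n}/f` absorbed into the factor `(f; q)_r / (q; q)_r`, `r + k = n`. The
`q`-Pfaff–Saalschütz sum expands `(B)_k (C)_k / ((q)_k (D)_k)`, and sums the inner series after the
order of summation is changed. -/
theorem qSears {q f A B C D E : ℂ} (hq0 : q ≠ 0) (hq : ∀ k : ℕ, 1 - q * q ^ k ≠ 0)
    (hA : A ≠ 0) (hB : B ≠ 0) (hC : C ≠ 0) (hD0 : D ≠ 0) (hbal : D * E = A * B * C * f)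
    (hD : ∀ k : ℕ, 1 - D * q ^ k ≠ 0) (hE : ∀ k : ℕ, 1 - E * q ^ k ≠ 0)
    (hfA : ∀ k : ℕ, 1 - f * A * q ^ k ≠ 0) (n : ℕ) :
    ∑ p ∈ antidiagonal n, qPoch f q p.1 / qPoch q q p.1 * (f ^ p.2 *
        (qPoch A q p.2 * qPoch B q p.2 * qPoch C q p.2) /
        (qPoch q q p.2 * qPoch D q p.2 * qPoch E q p.2)) =
    qPoch (f * A) q n / qPoch E q n *
      ∑ p ∈ antidiagonal n, qPoch (E / A) q p.1 / qPoch q q p.1 * ((E / A) ^ p.2 *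
        (qPoch A q p.2 * qPoch (D / B) q p.2 * qPoch (D / C) q p.2) /
        (qPoch q q p.2 * qPoch D q p.2 * qPoch (f * A) q p.2)) := by
  have nq := qPoch_ne_zero hq
  have nD := qPoch_ne_zero hD
  have nE := qPoch_ne_zero hE
  have nfA := qPoch_ne_zero hfA
  set Y := B * C / D with hY
  have hfY : f * Y = E / A := by rw [hY]; field_simp; linear_combination -hbal
  have inner (k : ℕ) := qSaalschutz (w := Y) (x := D / B) (y := D / C) (D := D) hq hD hq0
    (by rw [hY]; field_simp) k
  rw [show Y * (D / B) = C by rw [hY]; field_simp, show Y * (D / C) = B by rw [hY]; field_simp]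
    at inner
  have outer (j N : ℕ) := qSaalschutz (w := f) (x := A * q ^ j) (y := Y) (D := E * q ^ j) hq
    (fun k => by rw [mul_assoc, ← pow_add]; exact hE _) hq0
    (by rw [show f * (A * q ^ j) * Y = f * Y * A * q ^ j by ring, hfY]; field_simp) N
  calc _ = ∑ p ∈ antidiagonal n, ∑ t ∈ antidiagonal p.2,
        qPoch f q p.1 / qPoch q q p.1 * (f ^ (t.2 + t.1) *
        (qPoch A q (t.2 + t.1) / qPoch E q (t.2 + t.1)) * (qPoch Y q t.1 / qPoch q q t.1 *
        (qPoch (D / B) q t.2 * qPoch (D / C) q t.2 * Y ^ t.2 /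
          (qPoch q q t.2 * qPoch D q t.2)))) := by
        refine sum_congr rfl fun p _ => ?_
        trans qPoch f q p.1 / qPoch q q p.1 * (f ^ p.2 * (qPoch A q p.2 / qPoch E q p.2) *
          (qPoch C q p.2 * qPoch B q p.2 / (qPoch q q p.2 * qPoch D q p.2)))
        · have := nq p.1; have := nq p.2; have := nD p.2; have := nE p.2
          field_simp
        · rw [← inner, mul_sum, mul_sum]
          refine sum_congr rfl fun t ht => ?_
          rw [add_comm t.2, mem_antidiagonal.1 ht]
    _ = ∑ p ∈ antidiagonal n, (f * Y) ^ p.2 * (qPoch (D / B) q p.2 * qPoch (D / C) q p.2 /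
          (qPoch q q p.2 * qPoch D q p.2)) * (qPoch A q p.2 / qPoch E q p.2) *
        (∑ t ∈ antidiagonal p.1, qPoch f q t.1 / qPoch q q t.1 *
          (qPoch (A * q ^ p.2) q t.2 * qPoch Y q t.2 * f ^ t.2 /
            (qPoch q q t.2 * qPoch (E * q ^ p.2) q t.2))) := by
        rw [sum_antidiagonal_antidiagonal_assoc (fun r s j =>
          qPoch f q r / qPoch q q r * (f ^ (j + s) *
          (qPoch A q (j + s) / qPoch E q (j + s)) * (qPoch Y q s / qPoch q q s *
          (qPoch (D / B) q j * qPoch (D / C) q j * Y ^ j / (qPoch q q j * qPoch D q j)))))]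
        refine sum_congr rfl fun p _ => ?_
        rw [mul_sum]
        refine sum_congr rfl fun t _ => ?_
        rw [qPoch_add, qPoch_add, pow_add, mul_pow]
        ring
    _ = _ := by
        rw [mul_sum]
        refine sum_congr rfl fun p hp => ?_
        have e := mem_antidiagonal.1 hp
        have h1 := qPoch_add (f * A) q p.2 p.1
        have h2 := qPoch_add E q p.2 p.1
        have h3 := nE n
        rw [add_comm, e] at h1 h2
        rw [h2] at h3
        rw [outer, h1, h2, hfY, ← mul_assoc]
        generalize f * A = g at *
        have := nq p.1; have := nq p.2; have := nD p.2; have := nfA p.2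
        have := left_ne_zero_of_mul h3; have := right_ne_zero_of_mul h3
        field_simp

/-! ### Andrews' `q`-Watson sum -/

/-- The coefficient `(α; q²)_i / ((q; q)_i (α; q)_i)`. -/
noncomputable def watsonCoeff (q α : ℂ) (i : ℕ) : ℂ :=
  qPoch α (q ^ 2) i / (qPoch q q i * qPoch α q i)

theorem watsonCoeff_succ {q α : ℂ} (hq : ∀ k : ℕ, 1 - q * q ^ k ≠ 0)
    (hα : ∀ k : ℕ, 1 - α * q ^ k ≠ 0) (i : ℕ) :
    (1 - q * q ^ i) * (1 - α * q ^ i) * watsonCoeff q α (i + 1) =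
      (1 - α * q ^ (2 * i)) * watsonCoeff q α i := by
  have := qPoch_ne_zero hq i; have := hq i; have := qPoch_ne_zero hα i; have := hα i
  simp only [watsonCoeff, qPoch_succ, pow_mul]
  generalize 1 - α * q ^ i = s at *
  field_simp

/-- The recurrence of step two behind the `q`-Watson sum. -/
theorem watson_recurrence {q α γ : ℂ} (hq0 : q ≠ 0) (hq : ∀ k : ℕ, 1 - q * q ^ k ≠ 0)
    (hα : ∀ k : ℕ, 1 - α * q ^ k ≠ 0) (hγ : ∀ k : ℕ, 1 - γ * q ^ k ≠ 0) (n : ℕ) :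
    (1 - q * q ^ (n + 1)) * (1 - α * q ^ (n + 1)) * (1 - γ * q ^ (n + 1)) * (1 - α * γ * q ^ n) *
      ∑ p ∈ antidiagonal (n + 2), watsonCoeff q α p.1 * ((-1) ^ p.2 * watsonCoeff q γ p.2) =
    (1 - α * γ * q ^ (2 * n)) * (1 - α * γ * q ^ (2 * n + 2)) *
      ∑ p ∈ antidiagonal n, watsonCoeff q α p.1 * ((-1) ^ p.2 * watsonCoeff q γ p.2) := by
  set a := watsonCoeff q α
  set b : ℕ → ℂ := fun k => (-1) ^ k * watsonCoeff q γ k with hb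
  change _ * ∑ p ∈ antidiagonal (n + 2), a p.1 * b p.2 = _ * ∑ p ∈ antidiagonal n, a p.1 * b p.2
  have ha' := watsonCoeff_succ hq hα
  have hb' (k : ℕ) : (1 - q * q ^ k) * (1 - γ * q ^ k) * b (k + 1) =
      -(1 - γ * q ^ (2 * k)) * b k := by
    simp only [hb, pow_succ]
    linear_combination -(-1) ^ k * watsonCoeff_succ hq hγ k
  -- Lowering the first, respectively the second index by one.
  have hL (X : ℕ → ℕ → ℂ) (n : ℕ) : ∑ p ∈ antidiagonal (n + 1),
      X p.1 p.2 * ((1 - q ^ p.1) * (1 - α * q ^ p.1 / q)) * (a p.1 * b p.2) =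
      ∑ p ∈ antidiagonal n, X (p.1 + 1) p.2 * (1 - α * q ^ (2 * p.1)) * (a p.1 * b p.2) := by
    rw [Nat.sum_antidiagonal_succ]
    simp only [pow_zero, sub_self, zero_mul, mul_zero, zero_add]
    refine sum_congr rfl fun p _ => ?_
    have h := ha' p.1
    rw [show α * q ^ (p.1 + 1) / q = α * q ^ p.1 by rw [pow_succ]; field_simp, pow_succ']
    linear_combination X (p.1 + 1) p.2 * b p.2 * h
  have hR (X : ℕ → ℕ → ℂ) (n : ℕ) : ∑ p ∈ antidiagonal (n + 1),
      X p.1 p.2 * ((1 - q ^ p.2) * (1 - γ * q ^ p.2 / q)) * (a p.1 * b p.2) =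
      -∑ p ∈ antidiagonal n, X p.1 (p.2 + 1) * (1 - γ * q ^ (2 * p.2)) * (a p.1 * b p.2) := by
    rw [Nat.sum_antidiagonal_succ', ← sum_neg_distrib]
    simp only [pow_zero, sub_self, zero_mul, mul_zero, zero_add]
    refine sum_congr rfl fun p _ => ?_
    have h := hb' p.2
    rw [show γ * q ^ (p.2 + 1) / q = γ * q ^ p.2 by rw [pow_succ]; field_simp, pow_succ']
    linear_combination X p.1 (p.2 + 1) * a p.1 * h
  -- `X`, `Y` and `X'`, `Y'` write the factor in front of the sum, respectively what is left after
  -- one lowering step, as a combination of the factors in `hL` and `hR`.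
  let X : ℕ → ℕ → ℂ := fun i k => 1 - γ / q * (1 + α / q) * q ^ i * (q ^ k) ^ 2
    - α * γ / q ^ 2 * (q ^ i) ^ 2 * (q ^ k) ^ 2
    + α * γ / q ^ 2 * (1 + γ / q) * (q ^ i) ^ 2 * (q ^ k) ^ 3
  let Y : ℕ → ℕ → ℂ := fun i k => (1 + α / q) * q ^ i - α / q * (q ^ i) ^ 2
    - α / q * (1 + γ / q) * (q ^ i) ^ 2 * q ^ k + α ^ 2 * γ / q ^ 3 * (q ^ i) ^ 4 * (q ^ k) ^ 2
  let X' : ℕ → ℕ → ℂ := fun i k => 1 - α * γ * (q ^ i) ^ 2 * (q ^ k) ^ 2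
  let Y' : ℕ → ℕ → ℂ := fun i k => - α * (q ^ i) ^ 2 * (1 - α * γ * (q ^ i) ^ 2 * (q ^ k) ^ 2)
  have h1 : (1 - q * q ^ (n + 1)) * (1 - α * q ^ (n + 1)) * (1 - γ * q ^ (n + 1)) *
      (1 - α * γ * q ^ n) * ∑ p ∈ antidiagonal (n + 2), a p.1 * b p.2 =
      ∑ p ∈ antidiagonal (n + 2),
        X p.1 p.2 * ((1 - q ^ p.1) * (1 - α * q ^ p.1 / q)) * (a p.1 * b p.2) +
      ∑ p ∈ antidiagonal (n + 2),
        Y p.1 p.2 * ((1 - q ^ p.2) * (1 - γ * q ^ p.2 / q)) * (a p.1 * b p.2) := by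
    rw [mul_sum, ← sum_add_distrib]
    refine sum_congr rfl fun p hp => ?_
    have e : q ^ n = q ^ p.1 * q ^ p.2 / q ^ 2 := by
      rw [← pow_add, mem_antidiagonal.1 hp, pow_add]; field_simp
    simp only [X, Y]
    rw [pow_succ, e]; field_simp; ring
  have h2 : ∑ p ∈ antidiagonal (n + 1),
        X (p.1 + 1) p.2 * (1 - α * q ^ (2 * p.1)) * (a p.1 * b p.2) +
      -∑ p ∈ antidiagonal (n + 1),
        Y p.1 (p.2 + 1) * (1 - γ * q ^ (2 * p.2)) * (a p.1 * b p.2) =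
      ∑ p ∈ antidiagonal (n + 1),
        X' p.1 p.2 * ((1 - q ^ p.1) * (1 - α * q ^ p.1 / q)) * (a p.1 * b p.2) +
      ∑ p ∈ antidiagonal (n + 1),
        Y' p.1 p.2 * ((1 - q ^ p.2) * (1 - γ * q ^ p.2 / q)) * (a p.1 * b p.2) := by
    rw [← sub_eq_add_neg, ← sum_sub_distrib, ← sum_add_distrib]
    refine sum_congr rfl fun p hp => ?_
    simp only [X, Y, X', Y', pow_succ q, mul_comm 2, pow_mul]
    field_simp; ring
  rw [h1, hL, hR, h2, hL, hR, ← sub_eq_add_neg, ← sum_sub_distrib, mul_sum]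
  refine sum_congr rfl fun p hp => ?_
  have e : q ^ n = q ^ p.1 * q ^ p.2 := by rw [← pow_add, mem_antidiagonal.1 hp]
  simp only [X', Y', pow_succ q, mul_comm 2, pow_mul, e]
  ring

/-- Andrews' `q`-Watson sum for an odd index. -/
theorem qWatson_odd {q α γ : ℂ} (hq0 : q ≠ 0) (hq : ∀ k : ℕ, 1 - q * q ^ k ≠ 0)
    (hα : ∀ k : ℕ, 1 - α * q ^ k ≠ 0) (hγ : ∀ k : ℕ, 1 - γ * q ^ k ≠ 0)
    (hαγ : ∀ k : ℕ, 1 - α * γ * q ^ k ≠ 0) (h : ℕ) :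
    ∑ p ∈ antidiagonal (2 * h + 1),
      watsonCoeff q α p.1 * ((-1) ^ p.2 * watsonCoeff q γ p.2) = 0 := by
  induction h with
  | zero =>
    have h1 := hq 0; have h2 := hα 0; have h3 := hγ 0
    simp only [pow_zero, mul_one] at h1 h2 h3
    simp [Nat.sum_antidiagonal_succ, watsonCoeff, qPoch_succ]
    field_simp
    simp
  | succ h ih =>
    have r := watson_recurrence hq0 hq hα hγ (2 * h + 1)
    rw [ih, mul_zero] at r
    have := hq (2 * h + 1 + 1); have := hα (2 * h + 1 + 1); have := hγ (2 * h + 1 + 1)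
    have := hαγ (2 * h + 1)
    exact (mul_eq_zero.1 r).resolve_left (by positivity)

/-- Andrews' `q`-Watson sum for an even index. -/
theorem qWatson_even {q α γ : ℂ} (hq0 : q ≠ 0) (hq : ∀ k : ℕ, 1 - q * q ^ k ≠ 0)
    (hα : ∀ k : ℕ, 1 - α * q ^ k ≠ 0) (hγ : ∀ k : ℕ, 1 - γ * q ^ k ≠ 0)
    (hαγ : ∀ k : ℕ, 1 - α * γ * q ^ k ≠ 0) (h : ℕ) :
    ∑ p ∈ antidiagonal (2 * h), watsonCoeff q α p.1 * ((-1) ^ p.2 * watsonCoeff q γ p.2) =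
      qPoch (α * γ * q ^ (2 * h)) (q ^ 2) h / (qPoch (q ^ 2) (q ^ 2) h *
        qPoch (α * q) (q ^ 2) h * qPoch (γ * q) (q ^ 2) h) := by
  induction h with
  | zero => simp [watsonCoeff]
  | succ h ih =>
    have r := watson_recurrence hq0 hq hα hγ (2 * h)
    rw [ih] at r
    have e (x y : ℂ) (hx : ∀ k : ℕ, 1 - x * q ^ k ≠ 0) (hy : y = x * q) :
        qPoch y (q ^ 2) h ≠ 0 := prod_ne_zero_iff.2 fun k _ => by
      rw [hy, ← pow_mul, mul_assoc, ← pow_succ']; exact hx _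
    have n1 := e q (q ^ 2) hq (sq q)
    have n2 := e α _ hα rfl
    have n3 := e γ _ hγ rfl
    have := hq (2 * h + 1); have := hα (2 * h + 1); have := hγ (2 * h + 1)
    have := hαγ (2 * h)
    have s : (1 - α * γ * q ^ (2 * h)) * qPoch (α * γ * q ^ (2 * h + 2)) (q ^ 2) (h + 1) =
        qPoch (α * γ * q ^ (2 * h)) (q ^ 2) h *
          ((1 - α * γ * q ^ (2 * (2 * h))) * (1 - α * γ * q ^ (2 * (2 * h) + 2))) := by
      have s1 := qPoch_add (α * γ * q ^ (2 * h)) (q ^ 2) 1 (h + 1)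
      rw [show 1 + (h + 1) = h + 1 + 1 by ring, qPoch_succ _ _ (h + 1), qPoch_succ _ _ h,
        qPoch_succ _ _ 0] at s1
      simp only [pow_zero, mul_one, qPoch_zero, one_mul, pow_one] at s1
      rw [pow_add q (2 * h) 2, ← mul_assoc (α * γ), ← s1]
      ring
    rw [show 2 * (h + 1) = 2 * h + 2 by ring, qPoch_succ (q ^ 2), qPoch_succ (α * q),
      qPoch_succ (γ * q), eq_div_iff, ← mul_right_inj' (hαγ (2 * h)), s]
    · rw [mul_div_assoc', eq_div_iff (by positivity)] at r
      have e1 (x : ℂ) : x * q * (q ^ 2) ^ h = x * q ^ (2 * h + 1) := by ring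
      rw [e1, e1, show q ^ 2 * (q ^ 2) ^ h = q * q ^ (2 * h + 1) by ring]
      linear_combination r
    · have e1 (x : ℂ) : x * q * (q ^ 2) ^ h = x * q ^ (2 * h + 1) := by ring
      rw [e1, e1, show q ^ 2 * (q ^ 2) ^ h = q * q ^ (2 * h + 1) by ring]
      positivity

/-! ### Genericity -/

/-- `x` is not an integral power of `q`. -/
def OffLattice (q x : ℂ) : Prop := ∀ e : ℤ, x ≠ q ^ e

namespace OffLattice

variable {q x : ℂ}

theorem mul_zpow (h : OffLattice q x) (hq : q ≠ 0) (e : ℤ) : OffLattice q (x * q ^ e) := by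
  intro e' he
  refine h (e' - e) ?_
  rw [zpow_sub₀ hq, ← he, mul_div_cancel_right₀ _ (zpow_ne_zero _ hq)]

theorem mul_pow (h : OffLattice q x) (hq : q ≠ 0) (e : ℕ) : OffLattice q (x * q ^ e) := by
  simpa using h.mul_zpow hq e

theorem inv (h : OffLattice q x) : OffLattice q x⁻¹ := by
  intro e he
  exact h (-e) (by rw [zpow_neg, ← he, inv_inv])

theorem of_sq (h : OffLattice q (x ^ 2)) : OffLattice q x := by
  intro e he
  exact h (e * 2) (by rw [he, zpow_mul]; norm_cast)

theorem one_sub_ne_zero (h : OffLattice q x) (k : ℕ) : 1 - x * q ^ k ≠ 0 := by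
  intro h0
  refine h (-k) ?_
  rw [zpow_neg, zpow_natCast]
  exact eq_inv_of_mul_eq_one_left (sub_eq_zero.1 h0).symm

theorem qPoch_ne_zero (h : OffLattice q x) (n : ℕ) : qPoch x q n ≠ 0 :=
  _root_.qPoch_ne_zero h.one_sub_ne_zero n

theorem qPoch_sq_ne_zero (h : OffLattice q x) (n : ℕ) : qPoch x (q ^ 2) n ≠ 0 :=
  _root_.qPoch_ne_zero (fun k => by rw [← pow_mul]; exact h.one_sub_ne_zero _) n

end OffLattice

/-! ### Removal of the shifts -/

theorem qPoch_reverse_div {q x y : ℂ} (hq : q ≠ 0) (hx : x ≠ 0) (hy : y ≠ 0) {n r k : ℕ}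
    (hn : r + k = n) (hxr : qPoch x q r ≠ 0) (hyn : qPoch y q n ≠ 0) :
    qPoch (q ^ (1 - n : ℤ) / x) q k / qPoch (q ^ (1 - n : ℤ) / y) q k =
      (y / x) ^ k * (qPoch x q n * qPoch y q r / (qPoch x q r * qPoch y q n)) := by
  subst hn
  have h1 := qPoch_reverse hq hx r k
  have h2 := qPoch_reverse hq hy r k
  have h3 : (-1 : ℂ) ^ k * qPoch y q (r + k) ≠ 0 := mul_ne_zero (by simp) hyn
  rw [← h2] at h3
  have h4 : qPoch (q ^ (1 - (r + k : ℕ) : ℤ) / y) q k ≠ 0 := by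
    intro h; rw [h, zero_mul, zero_mul, zero_mul] at h3; exact h3 rfl
  have h5 : q ^ (r * k + k.choose 2) ≠ 0 := pow_ne_zero _ hq
  have h6 : (-1 : ℂ) ^ k ≠ 0 := by simp
  rw [div_pow, div_eq_iff h4]
  field_simp
  apply mul_right_cancel₀ h5
  apply mul_right_cancel₀ h6
  linear_combination (-1) ^ k * qPoch y q (r + k) * h1 - (-1) ^ k * qPoch x q (r + k) * h2

/-- The coefficient of the `i`-th term in the expansion of a quotient of shifted factorials in
`x` and `-x q^m` into quotients with `m = 0`. -/
noncomputable def shiftCoeff (q x : ℂ) (m i : ℕ) : ℂ :=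
  (1 - x ^ 2 / q * q ^ (2 * i)) / (1 - x ^ 2 / q) *
    (qPoch (x ^ 2 / q) q i * qPoch (q ^ (-m : ℤ)) q i * (x * q ^ m) ^ i * q ^ i.choose 2 /
      (qPoch q q i * qPoch (x ^ 2 * q ^ m) q i)) *
    (qPoch (x ^ 2) (q ^ 2) i / qPoch (x ^ 2) q (2 * i))

/-- The case `d = -x`, `b = q^{-m}` of the very-well-poised sum. -/
theorem shift_expansion {q x : ℂ} (hq0 : q ≠ 0) (hq : ∀ k : ℕ, 1 - q * q ^ k ≠ 0)
    (hx : OffLattice q (x ^ 2)) (m r : ℕ) :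
    qPoch x q r * qPoch (-x * q ^ m) q r / (qPoch q q r * qPoch (x ^ 2 * q ^ m) q r) =
      ∑ i ∈ range (m + 1), if i ≤ r then
        shiftCoeff q x m i * watsonCoeff q (x ^ 2 * q ^ (2 * i)) (r - i) else 0 := by
  have hx' : OffLattice q (-x) := OffLattice.of_sq (by rwa [neg_sq])
  have nA : 1 - x ^ 2 / q ≠ 0 := by
    have := (hx.mul_zpow hq0 (-1)).one_sub_ne_zero 0
    simpa [div_eq_mul_inv] using this
  have nq := qPoch_ne_zero hq
  have main := qVWP_sum (A := x ^ 2 / q) (b := q ^ (-m : ℤ)) (d := -x) (e := x ^ 2 * q ^ m)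
    (β := -x * q ^ m) hq0 hq (by field_simp)
    (by rw [zpow_neg, zpow_natCast]; field_simp) (by ring)
    (by rw [neg_sq]; exact hx.one_sub_ne_zero) hx'.one_sub_ne_zero
    (hx.mul_pow hq0 m).one_sub_ne_zero r
  rw [eq_div_iff (by
    have := nq r; have := (hx.mul_pow hq0 m).qPoch_ne_zero r; have := hx'.qPoch_ne_zero r
    positivity)] at main
  have h0 : qPoch x q r * qPoch (-x * q ^ m) q r / (qPoch q q r * qPoch (x ^ 2 * q ^ m) q r) =
      ∑ p ∈ antidiagonal r,
        shiftCoeff q x m p.1 * watsonCoeff q (x ^ 2 * q ^ (2 * p.1)) p.2 := by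
    have h1 : ∑ p ∈ antidiagonal r,
        shiftCoeff q x m p.1 * watsonCoeff q (x ^ 2 * q ^ (2 * p.1)) p.2 =
        qPoch x q r * qPoch (-x) q r / (1 - x ^ 2 / q) *
        ∑ p ∈ antidiagonal r, (1 - x ^ 2 / q * q ^ (2 * p.1)) *
        (qPoch (x ^ 2 / q) q p.1 * qPoch (q ^ (-m : ℤ)) q p.1 * (- (-x * q ^ m)) ^ p.1 *
          q ^ p.1.choose 2 / (qPoch q q p.1 * qPoch (x ^ 2 * q ^ m) q p.1) /
          (qPoch q q p.2 * qPoch ((-x) ^ 2) q (2 * p.1 + p.2))) := by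
      rw [mul_sum]
      refine sum_congr rfl fun p hp => ?_
      have e1 : qPoch x q r * qPoch (-x) q r = qPoch (x ^ 2) (q ^ 2) p.1 *
          qPoch (x ^ 2 * q ^ (2 * p.1)) (q ^ 2) p.2 := by
        rw [← qPoch_sq, ← mem_antidiagonal.1 hp, qPoch_add, pow_mul]
      rw [e1, neg_sq, qPoch_add, shiftCoeff, watsonCoeff, neg_mul, neg_neg]
      have := nq p.1; have := nq p.2; have := (hx.mul_pow hq0 m).qPoch_ne_zero p.1
      have := hx.qPoch_ne_zero (2 * p.1)
      have := (hx.mul_pow hq0 (2 * p.1)).qPoch_ne_zero p.2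
      generalize 1 - x ^ 2 / q = s at *
      field_simp
    rw [h1]
    have := nq r; have := (hx.mul_pow hq0 m).qPoch_ne_zero r; have := hx'.qPoch_ne_zero r
    rw [div_eq_iff (by positivity)]
    generalize 1 - x ^ 2 / q = s at *
    rw [div_mul_eq_mul_div, div_mul_eq_mul_div, eq_div_iff nA]
    linear_combination -qPoch x q r * main
  rw [h0, Nat.sum_antidiagonal_eq_sum_range_succ_mk]
  have h2 : ∑ i ∈ range (r + 1), shiftCoeff q x m i * watsonCoeff q (x ^ 2 * q ^ (2 * i)) (r - i) =
      ∑ i ∈ range (r + 1), if i ≤ r then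
        shiftCoeff q x m i * watsonCoeff q (x ^ 2 * q ^ (2 * i)) (r - i) else 0 :=
    sum_congr rfl fun i hi => by rw [if_pos (Nat.lt_succ_iff.1 (mem_range.1 hi))]
  refine h2.trans ?_
  trans ∑ i ∈ range (r + m + 1), if i ≤ r then
        shiftCoeff q x m i * watsonCoeff q (x ^ 2 * q ^ (2 * i)) (r - i) else 0
  · refine sum_subset (range_subset_range.2 (by omega)) fun i _ hi => if_neg ?_
    simp at hi; omega
  · refine (sum_subset (range_subset_range.2 (by omega)) fun i _ hi => ?_).symm
    rw [shiftCoeff, qPoch_zpow_neg_eq_zero hq0 (by simp at hi; omega)]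
    simp

/-- The Cauchy product of `X^i f` and `X^j g`, for power series `f` and `g`. -/
theorem sum_antidiagonal_shift (f g : ℕ → ℂ) (n i j : ℕ) :
    ∑ p ∈ antidiagonal n, (if i ≤ p.1 then f (p.1 - i) else 0) *
        (if j ≤ p.2 then g (p.2 - j) else 0) =
      if i + j ≤ n then ∑ p ∈ antidiagonal (n - (i + j)), f p.1 * g p.2 else 0 := by
  have h := congrArg (PowerSeries.coeff n) (show
    (PowerSeries.X ^ i * PowerSeries.mk f) * (PowerSeries.X ^ j * PowerSeries.mk g) =
      PowerSeries.X ^ (i + j) * (PowerSeries.mk f * PowerSeries.mk g) by ring)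
  rw [PowerSeries.coeff_mul, PowerSeries.coeff_X_pow_mul', PowerSeries.coeff_mul] at h
  simpa only [PowerSeries.coeff_X_pow_mul', PowerSeries.coeff_mk] using h

theorem shift_convolution {q x y : ℂ} (hq0 : q ≠ 0) (hq : ∀ k : ℕ, 1 - q * q ^ k ≠ 0)
    (hx : OffLattice q (x ^ 2)) (hy : OffLattice q (y ^ 2)) (l m n : ℕ) :
    ∑ p ∈ antidiagonal n,
      qPoch x q p.1 * qPoch (-x * q ^ l) q p.1 / (qPoch q q p.1 * qPoch (x ^ 2 * q ^ l) q p.1) *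
      ((-1) ^ p.2 * (qPoch y q p.2 * qPoch (-y * q ^ m) q p.2 /
        (qPoch q q p.2 * qPoch (y ^ 2 * q ^ m) q p.2))) =
    ∑ i ∈ range (l + 1), ∑ j ∈ range (m + 1), if i + j ≤ n then
      shiftCoeff q x l i * ((-1) ^ j * shiftCoeff q y m j) *
        ∑ p ∈ antidiagonal (n - (i + j)), watsonCoeff q (x ^ 2 * q ^ (2 * i)) p.1 *
          ((-1) ^ p.2 * watsonCoeff q (y ^ 2 * q ^ (2 * j)) p.2) else 0 := by
  conv_lhs =>
    simp only [shift_expansion hq0 hq hx, shift_expansion hq0 hq hy,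
      mul_left_comm _ ((-1 : ℂ) ^ _), sum_mul_sum]
    simp only [mul_sum]
  rw [sum_comm]
  refine sum_congr rfl fun i _ => ?_
  rw [sum_comm]
  refine sum_congr rfl fun j _ => ?_
  have h := sum_antidiagonal_shift (watsonCoeff q (x ^ 2 * q ^ (2 * i)))
    (fun k => (-1) ^ k * watsonCoeff q (y ^ 2 * q ^ (2 * j)) k) n i j
  rw [← mul_ite_zero, ← h, mul_sum]
  refine sum_congr rfl fun p _ => ?_
  by_cases h1 : i ≤ p.1 <;> by_cases h2 : j ≤ p.2 <;> simp only [h1, h2, if_true, if_false,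
    zero_mul, mul_zero]
  have e : ((-1 : ℂ)) ^ p.2 = (-1) ^ j * (-1) ^ (p.2 - j) := by
    rw [← pow_add, Nat.add_sub_cancel' h2]
  rw [e]
  ring

/-! ### Identification of the terms of the double sum -/

theorem qPoch_two_mul (x q : ℂ) (n : ℕ) :
    qPoch x q (2 * n) = qPoch x (q ^ 2) n * qPoch (x * q) (q ^ 2) n := by
  induction n with
  | zero => simp
  | succ n ih =>
    rw [show 2 * (n + 1) = 2 * n + 1 + 1 by ring, qPoch_succ, qPoch_succ, ih, qPoch_succ,
      qPoch_succ]
    ring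

/-- The value of the `q`-Watson sum in terms of the quotient in base `q²` of the double sum. -/
theorem watson_closed_form {q α γ : ℂ} (hq0 : q ≠ 0) (hq : ∀ k : ℕ, 1 - q * q ^ k ≠ 0)
    (hα0 : α ≠ 0) (hγ0 : γ ≠ 0) (hα : OffLattice q α) (hγ : OffLattice q γ) (h : ℕ) :
    watsonCoeff q α (2 * h) * γ ^ h *
      (qPoch q (q ^ 2) h * qPoch (q ^ (2 - 4 * h : ℤ) / (α * γ)) (q ^ 2) h /
        (qPoch (q ^ (2 - 4 * h : ℤ) / α) (q ^ 2) h * qPoch (γ * q) (q ^ 2) h)) =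
      qPoch (α * γ * q ^ (2 * h)) (q ^ 2) h / (qPoch (q ^ 2) (q ^ 2) h *
        qPoch (α * q) (q ^ 2) h * qPoch (γ * q) (q ^ 2) h) := by
  have hp : q ^ (2 * h) ≠ 0 := pow_ne_zero _ hq0
  have n1 := (hα.mul_pow hq0 (2 * h)).qPoch_sq_ne_zero h
  have e (x : ℂ) : q ^ (2 - 4 * h : ℤ) / x = (q ^ 2) ^ (1 - h : ℤ) / (x * q ^ (2 * h)) := by
    have : q ^ (2 - 4 * h : ℤ) = (q ^ 2) ^ (1 - h : ℤ) / q ^ (2 * h) := by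
      rw [← zpow_natCast q 2, ← zpow_natCast q (2 * h), ← zpow_mul, ← zpow_sub₀ hq0]
      congr 1; push_cast; ring
    rw [this]; field_simp
  have r := qPoch_reverse_div (q := q ^ 2) (x := α * γ * q ^ (2 * h)) (y := α * q ^ (2 * h))
    (n := h) (r := 0) (k := h) (pow_ne_zero _ hq0) (by positivity) (by positivity) (by simp)
    (by simp) n1
  rw [← e, ← e, qPoch_zero, mul_one, qPoch_zero, one_mul,
    show α * q ^ (2 * h) / (α * γ * q ^ (2 * h)) = γ⁻¹ by field_simp, inv_pow] at r
  have n2 := hα.qPoch_sq_ne_zero h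
  have n3 : qPoch q (q ^ 2) h ≠ 0 := qPoch_ne_zero (fun k => by rw [← pow_mul]; exact hq _) h
  have n4 : qPoch (q ^ 2) (q ^ 2) h ≠ 0 := qPoch_ne_zero (fun k => by
    rw [sq q, mul_assoc, ← sq, ← pow_mul, ← pow_succ']; exact hq _) h
  have n5 : qPoch (α * q) (q ^ 2) h ≠ 0 := by
    simpa using (hα.mul_pow hq0 1).qPoch_sq_ne_zero h
  have n6 : qPoch (γ * q) (q ^ 2) h ≠ 0 := by
    simpa using (hγ.mul_pow hq0 1).qPoch_sq_ne_zero h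
  rw [mul_div_mul_comm (qPoch q (q ^ 2) h), mul_comm (qPoch (q ^ 2) (q ^ 2) h),
    ← mul_div_mul_comm, mul_comm (qPoch q (q ^ 2) h), mul_div_mul_comm, r, watsonCoeff, two_mul h,
    qPoch_add α, ← two_mul, qPoch_two_mul q, qPoch_two_mul α, ← pow_mul, ← sq]
  field_simp

/-- The very-well-poised factor combines with two shifted factorials into `1 / (x² q^{j-1}; q)_j`. -/
theorem shiftCoeff_eq {q x : ℂ} (hq0 : q ≠ 0) (hx : OffLattice q (x ^ 2)) (m j : ℕ) :
    shiftCoeff q x m j = qPoch (q ^ (-m : ℤ)) q j * (x * q ^ m) ^ j * q ^ j.choose 2 /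
      (qPoch q q j * qPoch (x ^ 2 * q ^ m) q j) *
      (qPoch (x ^ 2) (q ^ 2) j / qPoch (x ^ 2 / q * q ^ j) q j) := by
  have hA : OffLattice q (x ^ 2 / q) := by
    simpa [div_eq_mul_inv] using hx.mul_zpow hq0 (-1)
  have nA : 1 - x ^ 2 / q ≠ 0 := by simpa using hA.one_sub_ne_zero 0
  have h1 : qPoch (x ^ 2 / q) q j * qPoch (x ^ 2 / q * q ^ j) q j *
      (1 - x ^ 2 / q * q ^ (2 * j)) = (1 - x ^ 2 / q) * qPoch (x ^ 2) q (2 * j) := by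
    rw [← qPoch_add, ← two_mul, ← qPoch_succ, add_comm, qPoch_add, pow_one,
      div_mul_cancel₀ _ hq0]
    simp [qPoch_succ]
  have n1 := (hA.mul_pow hq0 j).qPoch_ne_zero j
  have n2 := hx.qPoch_ne_zero (2 * j)
  rw [shiftCoeff]
  generalize 1 - x ^ 2 / q = s at *
  have h2 : (1 - x ^ 2 / q * q ^ (2 * j)) / s * qPoch (x ^ 2 / q) q j / qPoch (x ^ 2) q (2 * j) =
      1 / qPoch (x ^ 2 / q * q ^ j) q j := by
    rw [div_mul_eq_mul_div, div_div, div_eq_div_iff (by positivity) n1]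
    linear_combination h1
  trans (1 - x ^ 2 / q * q ^ (2 * j)) / s * qPoch (x ^ 2 / q) q j / qPoch (x ^ 2) q (2 * j) *
    (qPoch (q ^ (-m : ℤ)) q j * (x * q ^ m) ^ j * q ^ j.choose 2 /
      (qPoch q q j * qPoch (x ^ 2 * q ^ m) q j) * qPoch (x ^ 2) (q ^ 2) j)
  · ring
  · rw [h2]; ring

/-- The factors of a term that depend on `j`, after `n` is replaced by `M = n - i` and `a²` by
`α = v² q^{2i}`; the left side also contains the coefficient of index `M`. -/
theorem inner_factor {q α c : ℂ} (hq0 : q ≠ 0) (hq : ∀ k : ℕ, 1 - q * q ^ k ≠ 0)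
    (hα0 : α ≠ 0) (hc0 : c ≠ 0) (hα : OffLattice q α) (hc : OffLattice q (c ^ 2))
    {M : ℕ} (m j h : ℕ) (hM : 2 * h + j = M) :
    watsonCoeff q α M * (q ^ (2 * h * j + j + j.choose 2 + m * j) * c ^ M) *
      (qPoch (q ^ (-m : ℤ)) q j * qPoch (q ^ (1 - M : ℤ) / q) q j * qPoch (q ^ (1 - M : ℤ) / α) q j *
          qPoch (c ^ 2) (q ^ 2) j /
        (qPoch q q j * qPoch ((q ^ 2) ^ (1 - M : ℤ) / α) (q ^ 2) j * qPoch (c ^ 2 * q ^ m) q j *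
          qPoch (c ^ 2 / q * q ^ j) q j)) *
      (qPoch q (q ^ 2) h * qPoch (q ^ (2 - 4 * h : ℤ) / (α * (c ^ 2 * q ^ (2 * j)))) (q ^ 2) h /
        (qPoch (q ^ (2 - 4 * h : ℤ) / α) (q ^ 2) h * qPoch (c ^ 2 * q ^ (2 * j) * q) (q ^ 2) h)) =
    (-1) ^ j * shiftCoeff q c m j * (qPoch (α * (c ^ 2 * q ^ (2 * j)) * q ^ (2 * h)) (q ^ 2) h /
      (qPoch (q ^ 2) (q ^ 2) h * qPoch (α * q) (q ^ 2) h *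
        qPoch (c ^ 2 * q ^ (2 * j) * q) (q ^ 2) h)) := by
  rw [← watson_closed_form hq0 hq hα0 (by positivity) hα (hc.mul_pow hq0 _), shiftCoeff_eq hq0 hc]
  generalize qPoch q (q ^ 2) h * qPoch (q ^ (2 - 4 * h : ℤ) / (α * (c ^ 2 * q ^ (2 * j))))
    (q ^ 2) h / (qPoch (q ^ (2 - 4 * h : ℤ) / α) (q ^ 2) h *
      qPoch (c ^ 2 * q ^ (2 * j) * q) (q ^ 2) h) = W
  have nq := qPoch_ne_zero hq
  have r1 := qPoch_reverse hq0 hq0 (2 * h) j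
  have r2 := qPoch_reverse hq0 hα0 (2 * h) j
  have r3 := qPoch_reverse (q := q ^ 2) (pow_ne_zero _ hq0) hα0 (2 * h) j
  rw [hM] at r1 r2 r3
  have n1 := nq (2 * h); have n2 := nq M; have n3 := hα.qPoch_ne_zero (2 * h)
  have n4 := hα.qPoch_ne_zero M; have n5 := hα.qPoch_sq_ne_zero (2 * h)
  have n6 := hα.qPoch_sq_ne_zero M
  have hs : ((-1 : ℂ) ^ j) ≠ 0 := by simp
  have n7 : qPoch ((q ^ 2) ^ (1 - M : ℤ) / α) (q ^ 2) j ≠ 0 := fun h0 => by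
    rw [h0, zero_mul, zero_mul, zero_mul] at r3
    exact mul_ne_zero hs n6 r3.symm
  rw [show (q ^ 2) ^ (2 * h * j + j.choose 2) = (q ^ (2 * h * j + j.choose 2)) ^ 2 by
    rw [← pow_mul, ← pow_mul, mul_comm]] at r3
  have hR : q ^ (2 * h * j + j.choose 2) ≠ 0 := pow_ne_zero _ hq0
  rw [show q ^ (2 * h * j + j + j.choose 2 + m * j) =
    q ^ (2 * h * j + j.choose 2) * q ^ j * q ^ (m * j) by ring]
  have hR2 : (c ^ 2 * q ^ (2 * j)) ^ h * c ^ j * q ^ j.choose 2 =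
      c ^ M * q ^ (2 * h * j + j.choose 2) := by
    rw [← hM]; ring
  generalize q ^ (2 * h * j + j.choose 2) = R at *
  have key : watsonCoeff q α M * q ^ j * (qPoch (q ^ (1 - M : ℤ) / q) q j *
      qPoch (q ^ (1 - M : ℤ) / α) q j / qPoch ((q ^ 2) ^ (1 - M : ℤ) / α) (q ^ 2) j) =
      (-1) ^ j * watsonCoeff q α (2 * h) := by
    have hq' : q ^ j ≠ 0 := pow_ne_zero _ hq0
    have hα' : α ^ j ≠ 0 := pow_ne_zero _ hα0
    have e1 : qPoch (q ^ (1 - M : ℤ) / q) q j =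
        (-1) ^ j * qPoch q q M / (qPoch q q (2 * h) * q ^ j * R) := by
      rw [eq_div_iff (by positivity), ← r1]; ring
    have e2 : qPoch (q ^ (1 - M : ℤ) / α) q j =
        (-1) ^ j * qPoch α q M / (qPoch α q (2 * h) * α ^ j * R) := by
      rw [eq_div_iff (by positivity), ← r2]; ring
    have e3 : qPoch ((q ^ 2) ^ (1 - M : ℤ) / α) (q ^ 2) j =
        (-1) ^ j * qPoch α (q ^ 2) M / (qPoch α (q ^ 2) (2 * h) * α ^ j * R ^ 2) := by
      rw [eq_div_iff (by positivity), ← r3]; ring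
    rw [watsonCoeff, watsonCoeff, e1, e2, e3]
    field_simp
  trans (watsonCoeff q α M * q ^ j * (qPoch (q ^ (1 - M : ℤ) / q) q j *
      qPoch (q ^ (1 - M : ℤ) / α) q j / qPoch ((q ^ 2) ^ (1 - M : ℤ) / α) (q ^ 2) j)) *
    (c ^ M * R) * (q ^ (m * j) * (qPoch (q ^ (-m : ℤ)) q j * qPoch (c ^ 2) (q ^ 2) j /
      (qPoch q q j * qPoch (c ^ 2 * q ^ m) q j * qPoch (c ^ 2 / q * q ^ j) q j))) * W
  · ring
  · rw [key, ← hR2]; ring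

theorem mul_self_eq_add_choose_two (i : ℕ) : i * i = i + 2 * i.choose 2 := by
  induction i with
  | zero => rfl
  | succ i ih =>
    rw [Nat.choose_succ_succ' i 1, Nat.choose_one_right]
    linarith

/-- The factors of a term that depend on `i` only. -/
theorem outer_factor {q v : ℂ} (hq0 : q ≠ 0) (hq : ∀ k : ℕ, 1 - q * q ^ k ≠ 0)
    (hv : OffLattice q (v ^ 2)) {n M : ℕ} (l i : ℕ) (hn : M + i = n) :
    watsonCoeff q (v ^ 2) n * ((-1) ^ i * q ^ (n * i) * (v * q ^ l) ^ i *
      ((1 - v ^ 2 / q * q ^ (2 * i)) / (1 - v ^ 2 / q)) *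
      (qPoch (q ^ (-l : ℤ)) q i * qPoch (q ^ (1 - n : ℤ) / q) q i * qPoch (v ^ 2 / q) q i /
        (qPoch q q i * qPoch (v ^ 2 * q ^ n) q i * qPoch (v ^ 2 * q ^ l) q i))) =
    shiftCoeff q v l i * watsonCoeff q (v ^ 2 * q ^ (2 * i)) M := by
  have nq := qPoch_ne_zero hq
  have r1 := qPoch_reverse hq0 hq0 M i
  rw [hn] at r1
  have h1 : qPoch (v ^ 2) (q ^ 2) n = qPoch (v ^ 2) (q ^ 2) i *
      qPoch (v ^ 2 * q ^ (2 * i)) (q ^ 2) M := by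
    rw [← hn, add_comm, qPoch_add, pow_mul]
  have h2 : qPoch (v ^ 2) q n * qPoch (v ^ 2 * q ^ n) q i =
      qPoch (v ^ 2) q (2 * i) * qPoch (v ^ 2 * q ^ (2 * i)) q M := by
    rw [← qPoch_add, ← qPoch_add, ← hn]; congr 1; ring
  have hs2 : ((-1 : ℂ) ^ i) * (-1) ^ i = 1 := by rw [← mul_pow]; simp
  have h3 : q ^ (n * i) = q ^ i * q ^ (M * i + i.choose 2) * q ^ i.choose 2 := by
    rw [← hn, ← pow_add, ← pow_add]
    congr 1
    linear_combination mul_self_eq_add_choose_two i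
  have hR : q ^ (M * i + i.choose 2) ≠ 0 := pow_ne_zero _ hq0
  have hq' : q ^ i ≠ 0 := pow_ne_zero _ hq0
  have n1 := nq M; have n2 := nq n; have n3 := hv.qPoch_ne_zero n
  have n4 := (hv.mul_pow hq0 n).qPoch_ne_zero i
  have n5 := hv.qPoch_ne_zero (2 * i)
  have n6 := (hv.mul_pow hq0 (2 * i)).qPoch_ne_zero M
  have e1 : qPoch (q ^ (1 - n : ℤ) / q) q i =
      (-1) ^ i * qPoch q q n / (qPoch q q M * q ^ i * q ^ (M * i + i.choose 2)) := by
    rw [eq_div_iff (by positivity), ← r1]; ring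
  have e2 : qPoch (v ^ 2) q n = qPoch (v ^ 2) q (2 * i) * qPoch (v ^ 2 * q ^ (2 * i)) q M /
      qPoch (v ^ 2 * q ^ n) q i := by rw [eq_div_iff n4, h2]
  have key : watsonCoeff q (v ^ 2) n * ((-1) ^ i * q ^ (n * i)) *
      (qPoch (q ^ (1 - n : ℤ) / q) q i / qPoch (v ^ 2 * q ^ n) q i) =
      q ^ i.choose 2 * (qPoch (v ^ 2) (q ^ 2) i / qPoch (v ^ 2) q (2 * i)) *
        watsonCoeff q (v ^ 2 * q ^ (2 * i)) M := by
    rw [watsonCoeff, watsonCoeff, e1, e2, h1, h3]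
    generalize q ^ (M * i + i.choose 2) = R at *
    field_simp
    linear_combination (qPoch (v ^ 2) (q ^ 2) i * qPoch (v ^ 2 * q ^ (2 * i)) (q ^ 2) M) * hs2
  trans (watsonCoeff q (v ^ 2) n * ((-1) ^ i * q ^ (n * i)) *
      (qPoch (q ^ (1 - n : ℤ) / q) q i / qPoch (v ^ 2 * q ^ n) q i)) * ((v * q ^ l) ^ i *
      ((1 - v ^ 2 / q * q ^ (2 * i)) / (1 - v ^ 2 / q)) *
      (qPoch (q ^ (-l : ℤ)) q i * qPoch (v ^ 2 / q) q i /
        (qPoch q q i * qPoch (v ^ 2 * q ^ l) q i)))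
  · ring
  · rw [key, shiftCoeff]; ring

/-! ### The identity for generic parameters -/

theorem prefactor_eq {q v c : ℂ} (hq0 : q ≠ 0) (hq : ∀ k : ℕ, 1 - q * q ^ k ≠ 0) (hv0 : v ≠ 0)
    (hv : OffLattice q (v ^ 2)) {a : ℂ} {n l m : ℕ} (ha : a = v * q ^ l) :
    qFrac q [q ^ (1 + l - n : ℤ) / a ^ 2, -q / a] [q ^ (1 + l : ℤ) / a ^ 2, -q ^ (1 - n : ℤ) / a] l *
      qFrac q [-a, q ^ m * c ^ 2] [-(a * c), q ^ m * c] n =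
    qPoch q q n * qPoch (q ^ m * c * c) q n * qPoch (v * a) q n /
      (qPoch (q ^ m * c) q n * qPoch v q n * qPoch (-(a * c)) q n) *
      watsonCoeff q (v ^ 2) n := by
  have hv1 : OffLattice q v := hv.of_sq
  have hv2 : OffLattice q (-v) := OffLattice.of_sq (by rwa [neg_sq])
  have hl : q ^ l ≠ 0 := pow_ne_zero _ hq0
  have hn : q ^ n ≠ 0 := pow_ne_zero _ hq0
  have e1 : q ^ (1 + l - n : ℤ) / a ^ 2 = q ^ (1 - l : ℤ) / (v ^ 2 * q ^ n) := by
    rw [ha, zpow_sub₀ hq0, zpow_add₀ hq0, zpow_sub₀ hq0]; simp only [zpow_natCast, zpow_one]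
    field_simp
  have e2 : -q / a = q ^ (1 - l : ℤ) / (-v) := by
    rw [ha, zpow_sub₀ hq0]; simp only [zpow_natCast, zpow_one]; field_simp
  have e3 : q ^ (1 + l : ℤ) / a ^ 2 = q ^ (1 - l : ℤ) / (v ^ 2) := by
    rw [ha, zpow_add₀ hq0, zpow_sub₀ hq0]; simp only [zpow_natCast, zpow_one]
    field_simp
  have e4 : -q ^ (1 - n : ℤ) / a = q ^ (1 - l : ℤ) / (-v * q ^ n) := by
    rw [ha, zpow_sub₀ hq0, zpow_sub₀ hq0]; simp only [zpow_natCast, zpow_one]; field_simp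
  have n1 := hv.qPoch_ne_zero l
  have n2 := (hv2.mul_pow hq0 n).qPoch_ne_zero l
  have r1 := qPoch_reverse_div (x := v ^ 2 * q ^ n) (y := v ^ 2) hq0 (by positivity)
    (by positivity) (zero_add l) (by simp) n1
  have r2 := qPoch_reverse_div (x := -v) (y := -v * q ^ n) hq0 (by simpa)
    (mul_ne_zero (by simpa) hn) (zero_add l) (by simp) n2
  have s1 : qPoch (-v) q l * qPoch (-a) q n = qPoch (-v) q n * qPoch (-v * q ^ n) q l := by
    rw [← qPoch_add, add_comm n, qPoch_add, ha, neg_mul]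
  have s2 : qPoch (v ^ 2) q l * qPoch (v * a) q n =
      qPoch (v ^ 2) q n * qPoch (v ^ 2 * q ^ n) q l := by
    rw [← qPoch_add, add_comm n, qPoch_add, ha]; congr 2; ring
  have n3 := hv2.qPoch_ne_zero l
  have n4 := hv.qPoch_ne_zero n
  have n5 := qPoch_ne_zero hq n
  have n6 := hv1.qPoch_ne_zero n
  have s1' : qPoch (-a) q n = qPoch (-v) q n * qPoch (-v * q ^ n) q l / qPoch (-v) q l := by
    rw [eq_div_iff n3, ← s1, mul_comm]
  have s2' : qPoch (v * a) q n =
      qPoch (v ^ 2) q n * qPoch (v ^ 2 * q ^ n) q l / qPoch (v ^ 2) q l := by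
    rw [eq_div_iff n1, ← s2, mul_comm]
  simp only [qFrac, List.map_cons, List.map_nil, List.prod_cons, List.prod_nil, mul_one]
  rw [e1, e2, e3, e4, mul_div_mul_comm, r1, r2, s1', s2', watsonCoeff, qPoch_sq,
    show q ^ m * c * c = q ^ m * c ^ 2 by ring,
    show v ^ 2 / (v ^ 2 * q ^ n) = (q ^ n)⁻¹ by field_simp,
    show -v * q ^ n / -v = q ^ n by field_simp, inv_pow]
  have hnl : (q ^ n) ^ l ≠ 0 := pow_ne_zero _ hn
  simp only [qPoch_zero]
  generalize (q ^ n) ^ l = R at *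
  generalize -v * q ^ n = x at *
  field_simp

/-- Sears' transformation of the series on the left, with `f = q^m c`, `A = c`, `B = a`. -/
theorem series_transform {q v c : ℂ} (hq0 : q ≠ 0) (hq : ∀ k : ℕ, 1 - q * q ^ k ≠ 0)
    (hv0 : v ≠ 0) (hc0 : c ≠ 0) (hv : OffLattice q (v ^ 2)) (hc : OffLattice q (c ^ 2))
    {a : ℂ} {n l m : ℕ} (ha : a = v * q ^ l) (hac : OffLattice q ((a * c) ^ 2)) :
    ∑ k ∈ range (n + 1), basicHypTerm q q
      [q ^ (-n : ℤ), a, c, -q ^ (1 + l - m - n : ℤ) / (a * c)]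
      [q ^ (1 + l - n : ℤ) / a, q ^ (1 - m - n : ℤ) / c, -(a * c)] k =
    qPoch q q n * qPoch (q ^ m * c * c) q n * qPoch (v * a) q n /
      (qPoch (q ^ m * c) q n * qPoch v q n * qPoch (-(a * c)) q n) *
    ∑ p ∈ antidiagonal n,
      qPoch v q p.1 * qPoch (-v * q ^ l) q p.1 / (qPoch q q p.1 * qPoch (v ^ 2 * q ^ l) q p.1) *
      ((-1) ^ p.2 * (qPoch c q p.2 * qPoch (-c * q ^ m) q p.2 /
        (qPoch q q p.2 * qPoch (c ^ 2 * q ^ m) q p.2))) := by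
  have hl : q ^ l ≠ 0 := pow_ne_zero _ hq0
  have hm : q ^ m ≠ 0 := pow_ne_zero _ hq0
  have ha0 : a ≠ 0 := by rw [ha]; positivity
  have hv1 : OffLattice q v := hv.of_sq
  have hw : OffLattice q (q ^ m * c) := by rw [mul_comm]; exact hc.of_sq.mul_pow hq0 m
  have hE : OffLattice q (-(a * c)) := OffLattice.of_sq (by rwa [neg_sq])
  have hD : OffLattice q (q ^ (1 - n : ℤ) / v) := by
    rw [div_eq_mul_inv, mul_comm]; exact hv1.inv.mul_zpow hq0 _
  have hva : OffLattice q (v * a) := by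
    rw [ha, ← mul_assoc, ← sq]; exact hv.mul_pow hq0 l
  have hwc : OffLattice q (q ^ m * c * c) := by
    rw [mul_assoc, mul_comm, ← sq]; exact hc.mul_pow hq0 m
  have e1 : q ^ (-n : ℤ) = q ^ (1 - n : ℤ) / q := by
    rw [zpow_sub₀ hq0, zpow_neg]; simp only [zpow_natCast, zpow_one]; field_simp
  have e2 : q ^ (1 + l - n : ℤ) / a = q ^ (1 - n : ℤ) / v := by
    rw [ha, zpow_sub₀ hq0, zpow_add₀ hq0, zpow_sub₀ hq0]; simp only [zpow_natCast, zpow_one]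
    field_simp
  have e3 : q ^ (1 - m - n : ℤ) / c = q ^ (1 - n : ℤ) / (q ^ m * c) := by
    rw [sub_right_comm, zpow_sub₀ hq0 _ (m : ℤ)]; simp only [zpow_natCast]; field_simp
  have e4 : q ^ (1 + l - m - n : ℤ) = q ^ (1 - n : ℤ) * q ^ l / q ^ m := by
    rw [show (1 + l - m - n : ℤ) = 1 - n + l - m by ring, zpow_sub₀ hq0, zpow_add₀ hq0]
    simp only [zpow_natCast]
  have hz : q ^ (1 - n : ℤ) ≠ 0 := zpow_ne_zero _ hq0
  have hC0 : -q ^ (1 + l - m - n : ℤ) / (a * c) ≠ 0 := by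
    rw [e4]; exact div_ne_zero (neg_ne_zero.2 (by positivity)) (by positivity)
  have S := qSears (f := q ^ m * c) (A := c) (B := a) (C := -q ^ (1 + l - m - n : ℤ) / (a * c))
    (D := q ^ (1 - n : ℤ) / v) (E := -(a * c)) hq0 hq hc0 ha0 hC0 (by positivity)
    (by rw [e4, ha]; field_simp) hD.one_sub_ne_zero hE.one_sub_ne_zero hwc.one_sub_ne_zero n
  have d1 : q ^ (1 - n : ℤ) / v / a = q ^ (1 - n : ℤ) / (v * a) := by rw [div_div]
  have d2 : q ^ (1 - n : ℤ) / v / (-q ^ (1 + l - m - n : ℤ) / (a * c)) = -c * q ^ m := by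
    rw [e4, ha]; field_simp
  have d3 : -(a * c) / c = -a := by field_simp
  rw [d1, d2, d3] at S
  have nq := qPoch_ne_zero hq
  have nw := hw.qPoch_ne_zero
  have nv := hv1.qPoch_ne_zero
  have nva := hva.qPoch_ne_zero
  have nE := hE.qPoch_ne_zero
  have nwc := hwc.qPoch_ne_zero
  trans qPoch q q n / qPoch (q ^ m * c) q n *
    ∑ p ∈ antidiagonal n, qPoch (q ^ m * c) q p.1 / qPoch q q p.1 * ((q ^ m * c) ^ p.2 *
        (qPoch c q p.2 * qPoch a q p.2 * qPoch (-q ^ (1 + l - m - n : ℤ) / (a * c)) q p.2) /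
        (qPoch q q p.2 * qPoch (q ^ (1 - n : ℤ) / v) q p.2 * qPoch (-(a * c)) q p.2))
  · rw [← Nat.sum_antidiagonal_eq_sum_range_succ (fun k _ => basicHypTerm q q _ _ k),
      ← Nat.sum_antidiagonal_swap, mul_sum]
    refine sum_congr rfl fun p hp => ?_
    have r := qPoch_reverse_div hq0 hq0 (mul_ne_zero hm hc0) (mem_antidiagonal.1 hp) (nq _) (nw _)
    simp only [basicHypTerm, qFrac, List.map_cons, List.map_nil, List.prod_cons, List.prod_nil,
      mul_one, Prod.fst_swap]
    rw [e1, e2, e3]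
    trans qPoch (q ^ (1 - n : ℤ) / q) q p.2 / qPoch (q ^ (1 - n : ℤ) / (q ^ m * c)) q p.2 * q ^ p.2 *
      ((qPoch c q p.2 * qPoch a q p.2 * qPoch (-q ^ (1 + l - m - n : ℤ) / (a * c)) q p.2) /
        (qPoch q q p.2 * qPoch (q ^ (1 - n : ℤ) / v) q p.2 * qPoch (-(a * c)) q p.2))
    · ring
    · rw [r, div_pow]
      have : q ^ p.2 ≠ 0 := pow_ne_zero _ hq0
      have := nq p.1; have := nw n; have := nq p.2
      field_simp
  · rw [S, mul_sum, mul_sum, mul_sum]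
    refine sum_congr rfl fun p hp => ?_
    have r := qPoch_reverse_div hq0 (mul_ne_zero hv0 ha0) hv0 (mem_antidiagonal.1 hp) (nva _) (nv _)
    rw [show v / (v * a) = a⁻¹ by field_simp, inv_pow] at r
    have h1 : v ^ 2 * q ^ l = v * a := by rw [ha]; ring
    have h2 : c ^ 2 * q ^ m = q ^ m * c * c := by ring
    have h3 : -v * q ^ l = -a := by rw [ha]; ring
    rw [h1, h2, h3, neg_pow a]
    trans qPoch q q n / qPoch (q ^ m * c) q n * (qPoch (q ^ m * c * c) q n / qPoch (-(a * c)) q n *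
      (qPoch (-a) q p.1 / qPoch q q p.1 * ((-1) ^ p.2 * a ^ p.2 * (qPoch c q p.2 *
      (qPoch (q ^ (1 - n : ℤ) / (v * a)) q p.2 / qPoch (q ^ (1 - n : ℤ) / v) q p.2) *
        qPoch (-c * q ^ m) q p.2) / (qPoch q q p.2 * qPoch (q ^ m * c * c) q p.2))))
    · ring
    · rw [r]
      have : a ^ p.2 ≠ 0 := pow_ne_zero _ ha0
      have := nq p.1; have := nw n; have := nq p.2; have := nva p.1; have := nv n
      have := nE n; have := nwc p.2
      generalize q ^ m * c = w at *
      field_simp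

/-- The summand of the double sum without the parity factor. -/
noncomputable def doubleSumTerm (q a c : ℂ) (n l m i j : ℕ) : ℂ :=
  (-1) ^ i * q ^ (n * i + (m + n - i) * j - (j.choose 2 : ℕ) : ℤ) *
          a ^ i * c ^ (n - i : ℤ) *
          ((1 - q ^ (2 * i - 2 * l - 1 : ℤ) * a ^ 2) / (1 - q ^ (-2 * l - 1 : ℤ) * a ^ 2)) *
          qFrac q [q ^ (-l : ℤ), q ^ (-n : ℤ), q ^ (-2 * l - 1 : ℤ) * a ^ 2]
            [q, q ^ (n - 2 * l : ℤ) * a ^ 2, q ^ (-l : ℤ) * a ^ 2] i *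
          qFrac q
            [q ^ (-m : ℤ), q ^ (i - n : ℤ), q ^ (1 + 2 * l - n - i : ℤ) / a ^ 2, c, -c]
            [q, q ^ (1 + l - n : ℤ) / a, -q ^ (1 + l - n : ℤ) / a,
              q ^ m * c ^ 2, q ^ (j - 1 : ℤ) * c ^ 2] j *
          qFrac (q ^ 2)
            [q, q ^ (2 + 2 * l - 2 * n : ℤ) / (a ^ 2 * c ^ 2)]
            [q ^ (2 + 2 * l - 2 * n + 2 * j : ℤ) / a ^ 2, q ^ (1 + 2 * j) * c ^ 2]
            ((n - i - j) / 2)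

theorem doubleSumTerm_eq_zero {q : ℂ} (hq0 : q ≠ 0) (a c : ℂ) {n l m i j : ℕ} (h : n < i + j) :
    doubleSumTerm q a c n l m i j = 0 := by
  by_cases hi : n < i
  · simp only [doubleSumTerm, qFrac, List.map_cons, List.prod_cons, qPoch_zpow_neg_eq_zero hq0 hi,
      zero_mul, mul_zero, zero_div]
  · have h1 : (i - n : ℤ) = -(n - i : ℕ) := by omega
    have h2 : qPoch (q ^ (i - n : ℤ)) q j = 0 := by
      rw [h1]; exact qPoch_zpow_neg_eq_zero hq0 (by omega)
    simp only [doubleSumTerm, qFrac, List.map_cons, List.prod_cons, h2, zero_mul, mul_zero,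
      zero_div]

theorem doubleSumTerm_eq {q v c : ℂ} (hq0 : q ≠ 0) (hq : ∀ k : ℕ, 1 - q * q ^ k ≠ 0)
    (hv0 : v ≠ 0) (hc0 : c ≠ 0) (hv : OffLattice q (v ^ 2)) (hc : OffLattice q (c ^ 2))
    {a : ℂ} {n l m i j h : ℕ} (ha : a = v * q ^ l) (hn : n = i + j + 2 * h) :
    watsonCoeff q (v ^ 2) n * doubleSumTerm q a c n l m i j =
      shiftCoeff q v l i * ((-1) ^ j * shiftCoeff q c m j) *
        (qPoch (v ^ 2 * q ^ (2 * i) * (c ^ 2 * q ^ (2 * j)) * q ^ (2 * h)) (q ^ 2) h /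
          (qPoch (q ^ 2) (q ^ 2) h * qPoch (v ^ 2 * q ^ (2 * i) * q) (q ^ 2) h *
            qPoch (c ^ 2 * q ^ (2 * j) * q) (q ^ 2) h)) := by
  obtain ⟨M, hM⟩ : ∃ M, 2 * h + j = M := ⟨_, rfl⟩
  have hnM : M + i = n := by omega
  have I := inner_factor (α := v ^ 2 * q ^ (2 * i)) hq0 hq (by positivity) hc0
    (hv.mul_pow hq0 _) hc m j h hM
  have O := outer_factor hq0 hq hv l i hnM
  have hh : (n - i - j) / 2 = h := by omega
  have b1 : q ^ (n * i + (m + n - i) * j - (j.choose 2 : ℕ) : ℤ) =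
      q ^ (n * i) * q ^ (2 * h * j + j + j.choose 2 + m * j) := by
    rw [← pow_add, ← zpow_natCast]
    congr 1
    have := mul_self_eq_add_choose_two j
    zify at this
    subst hn
    push_cast
    linear_combination this
  have b2 : c ^ (n - i : ℤ) = c ^ M := by rw [← zpow_natCast]; congr 1; omega
  have hva : a ^ 2 = q ^ (2 * l : ℤ) * v ^ 2 := by
    rw [ha, mul_pow, ← pow_mul, mul_comm, mul_comm l]; congr 1
  have pp (e : ℤ) : q ^ e * a ^ 2 = q ^ (e + 2 * l) * v ^ 2 := by
    rw [hva, zpow_add₀ hq0]; ring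
  have pd (e : ℤ) (x : ℂ) : q ^ e / (a ^ 2 * x) = q ^ (e - 2 * l) / (v ^ 2 * x) := by
    rw [hva, zpow_sub₀ hq0]; field_simp
  have c1 : q ^ (2 * i - 2 * l - 1 : ℤ) * a ^ 2 = v ^ 2 / q * q ^ (2 * i) := by
    rw [pp, show (2 * i - 2 * l - 1 + 2 * l : ℤ) = (2 * i : ℕ) - 1 by push_cast; ring,
      zpow_sub₀ hq0, zpow_natCast, zpow_one]; ring
  have c2 : q ^ (-2 * l - 1 : ℤ) * a ^ 2 = v ^ 2 / q := by
    rw [pp, show (-2 * l - 1 + 2 * l : ℤ) = -1 by ring, zpow_neg_one]; ring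
  have c3 : q ^ (n - 2 * l : ℤ) * a ^ 2 = v ^ 2 * q ^ n := by
    rw [pp, show (n - 2 * l + 2 * l : ℤ) = n by ring, zpow_natCast, mul_comm]
  have c4 : q ^ (-l : ℤ) * a ^ 2 = v ^ 2 * q ^ l := by
    rw [pp, show (-l + 2 * l : ℤ) = l by ring, zpow_natCast, mul_comm]
  have c5 : q ^ (-n : ℤ) = q ^ (1 - n : ℤ) / q := by
    rw [zpow_sub₀ hq0, zpow_neg, zpow_natCast, zpow_one]; field_simp
  have c6 : q ^ (i - n : ℤ) = q ^ (1 - M : ℤ) / q := by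
    rw [show (i - n : ℤ) = 1 - M - 1 by omega, zpow_sub_one₀ hq0, div_eq_mul_inv]
  have c7 : q ^ (1 + 2 * l - n - i : ℤ) / a ^ 2 = q ^ (1 - M : ℤ) / (v ^ 2 * q ^ (2 * i)) := by
    rw [← mul_one (a ^ 2), pd, mul_one, mul_comm (v ^ 2), ← div_div, ← zpow_natCast q (2 * i),
      ← zpow_sub₀ hq0]
    congr 2; push_cast; omega
  have c8 : qPoch (q ^ (1 + l - n : ℤ) / a) q j * qPoch (-q ^ (1 + l - n : ℤ) / a) q j =
      qPoch ((q ^ 2) ^ (1 - M : ℤ) / (v ^ 2 * q ^ (2 * i))) (q ^ 2) j := by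
    rw [neg_div, ← qPoch_sq, div_pow, ← zpow_natCast (q ^ _) 2, ← zpow_mul, ← mul_one (a ^ 2), pd,
      mul_one, mul_comm (v ^ 2), ← div_div, ← zpow_natCast q (2 * i), ← zpow_natCast q 2,
      ← zpow_mul, ← zpow_sub₀ hq0]
    congr 3; push_cast; rw [← hnM]; push_cast; ring
  have c9 : qPoch c q j * qPoch (-c) q j = qPoch (c ^ 2) (q ^ 2) j := (qPoch_sq _ _ _).symm
  have c10 : q ^ (j - 1 : ℤ) * c ^ 2 = c ^ 2 / q * q ^ j := by
    rw [zpow_sub₀ hq0, zpow_natCast, zpow_one]; ring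
  have c11 : q ^ (2 + 2 * l - 2 * n : ℤ) / (a ^ 2 * c ^ 2) =
      q ^ (2 - 4 * h : ℤ) / (v ^ 2 * q ^ (2 * i) * (c ^ 2 * q ^ (2 * j))) := by
    rw [pd, show v ^ 2 * q ^ (2 * i) * (c ^ 2 * q ^ (2 * j)) =
      q ^ (2 * i + 2 * j) * (v ^ 2 * c ^ 2) by ring, ← div_div (q ^ (2 - 4 * h : ℤ)),
      ← zpow_natCast q (2 * i + 2 * j), ← zpow_sub₀ hq0]
    congr 2; push_cast; rw [hn]; push_cast; ring
  have c12 : q ^ (2 + 2 * l - 2 * n + 2 * j : ℤ) / a ^ 2 =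
      q ^ (2 - 4 * h : ℤ) / (v ^ 2 * q ^ (2 * i)) := by
    rw [← mul_one (a ^ 2), pd, mul_one, mul_comm (v ^ 2), ← div_div, ← zpow_natCast q (2 * i),
      ← zpow_sub₀ hq0]
    congr 2; push_cast; rw [hn]; push_cast; ring
  have c13 : q ^ (1 + 2 * j) * c ^ 2 = c ^ 2 * q ^ (2 * j) * q := by ring
  simp only [doubleSumTerm, qFrac, List.map_cons, List.map_nil, List.prod_cons, List.prod_nil,
    mul_one]
  rw [hh, c1, c2, c3, c4, c5, c6, c7, c10, c11, c12, c13, b1, b2,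
    ← mul_assoc (qPoch (q ^ (1 + l - n : ℤ) / a) q j), c8, c9, mul_comm (q ^ m) (c ^ 2)]
  rw [ha]
  trans (watsonCoeff q (v ^ 2) n * ((-1) ^ i * q ^ (n * i) * (v * q ^ l) ^ i *
      ((1 - v ^ 2 / q * q ^ (2 * i)) / (1 - v ^ 2 / q)) *
      (qPoch (q ^ (-l : ℤ)) q i * qPoch (q ^ (1 - n : ℤ) / q) q i * qPoch (v ^ 2 / q) q i /
        (qPoch q q i * qPoch (v ^ 2 * q ^ n) q i * qPoch (v ^ 2 * q ^ l) q i)))) *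
    ((q ^ (2 * h * j + j + j.choose 2 + m * j) * c ^ M) *
      (qPoch (q ^ (-m : ℤ)) q j * qPoch (q ^ (1 - M : ℤ) / q) q j *
        qPoch (q ^ (1 - M : ℤ) / (v ^ 2 * q ^ (2 * i))) q j * qPoch (c ^ 2) (q ^ 2) j /
        (qPoch q q j * qPoch ((q ^ 2) ^ (1 - M : ℤ) / (v ^ 2 * q ^ (2 * i))) (q ^ 2) j *
          qPoch (c ^ 2 * q ^ m) q j * qPoch (c ^ 2 / q * q ^ j) q j)) *
      (qPoch q (q ^ 2) h *
        qPoch (q ^ (2 - 4 * h : ℤ) / (v ^ 2 * q ^ (2 * i) * (c ^ 2 * q ^ (2 * j)))) (q ^ 2) h /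
        (qPoch (q ^ (2 - 4 * h : ℤ) / (v ^ 2 * q ^ (2 * i))) (q ^ 2) h *
          qPoch (c ^ 2 * q ^ (2 * j) * q) (q ^ 2) h)))
  · simp only [div_eq_mul_inv, mul_inv]; ring
  · rw [O, mul_assoc (shiftCoeff q v l i), ← mul_assoc (watsonCoeff _ _ _),
      ← mul_assoc (watsonCoeff _ _ _), I]
    ring

theorem chi_even (h : ℕ) : chi (2 * h : ℕ) = 1 := by
  rw [chi, zpow_natCast, pow_mul]; norm_num

theorem chi_odd (h : ℕ) : chi (2 * h + 1 : ℕ) = 0 := by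
  rw [chi, zpow_natCast, pow_succ, pow_mul]; norm_num

theorem series_eq_of_generic {q a c : ℂ} (hq0 : q ≠ 0) (hq : ∀ k : ℕ, 1 - q * q ^ k ≠ 0)
    (ha0 : a ≠ 0) (hc0 : c ≠ 0) (ha : OffLattice q (a ^ 2)) (hc : OffLattice q (c ^ 2))
    (hac : OffLattice q ((a * c) ^ 2)) (n l m : ℕ) :
    ∑ k ∈ range (n + 1), basicHypTerm q q
      [q ^ (-n : ℤ), a, c, -q ^ (1 + l - m - n : ℤ) / (a * c)]
      [q ^ (1 + l - n : ℤ) / a, q ^ (1 - m - n : ℤ) / c, -(a * c)] k =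
    qFrac q [q ^ (1 + l - n : ℤ) / a ^ 2, -q / a] [q ^ (1 + l : ℤ) / a ^ 2, -q ^ (1 - n : ℤ) / a] l *
      qFrac q [-a, q ^ m * c ^ 2] [-(a * c), q ^ m * c] n *
      ∑ i ∈ range (l + 1), ∑ j ∈ range (m + 1), doubleSumTerm q a c n l m i j * chi (n - i - j) := by
  have hl : q ^ l ≠ 0 := pow_ne_zero _ hq0
  obtain ⟨v, hv⟩ : ∃ v, a = v * q ^ l := ⟨a / q ^ l, by field_simp⟩
  have hv0 : v ≠ 0 := by rintro rfl; simp [hv] at ha0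
  have hv2 : OffLattice q (v ^ 2) := by
    have := ha.mul_zpow hq0 (-(2 * l))
    rwa [hv, mul_pow, mul_assoc, ← pow_mul, ← zpow_natCast q (l * 2), ← zpow_add₀ hq0,
      show ((l * 2 : ℕ) + -(2 * l) : ℤ) = 0 by push_cast; ring, zpow_zero, mul_one] at this
  rw [series_transform hq0 hq hv0 hc0 hv2 hc hv hac, prefactor_eq hq0 hq hv0 hv2 hv,
    shift_convolution hq0 hq hv2 hc, mul_assoc (_ / _)]
  congr 1
  rw [mul_sum]
  refine sum_congr rfl fun i _ => ?_
  rw [mul_sum]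
  refine sum_congr rfl fun j _ => ?_
  rw [← mul_assoc (watsonCoeff _ _ _)]
  by_cases hij : i + j ≤ n
  · rw [if_pos hij]
    have h1 := (hv2.mul_pow hq0 (2 * i)).one_sub_ne_zero
    have h2 := (hc.mul_pow hq0 (2 * j)).one_sub_ne_zero
    have h3 : OffLattice q (v ^ 2 * q ^ (2 * i) * (c ^ 2 * q ^ (2 * j))) := by
      have := hac.mul_zpow hq0 (-(2 * l : ℕ) + (2 * i + 2 * j : ℕ))
      rw [zpow_add₀ hq0, zpow_neg, zpow_natCast, zpow_natCast, hv] at this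
      convert this using 1
      field_simp
      ring
    obtain ⟨k, hk⟩ := Nat.exists_eq_add_of_le hij
    have e : (n - i - j : ℤ) = k := by omega
    rw [e, show n - (i + j) = k by omega]
    obtain ⟨h, rfl | rfl⟩ := Nat.even_or_odd' k
    · rw [qWatson_even hq0 hq h1 h2 h3.one_sub_ne_zero, chi_even, mul_one,
        doubleSumTerm_eq hq0 hq hv0 hc0 hv2 hc hv hk]
    · rw [qWatson_odd hq0 hq h1 h2 h3.one_sub_ne_zero, chi_odd, mul_zero, mul_zero]
  · rw [if_neg hij, doubleSumTerm_eq_zero hq0 _ _ (by omega), mul_zero, zero_mul]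

/-! ### Extension to all admissible parameters -/

/-- The triples `(q, a, c)` for which `q` is not a root of unity and `a²`, `c²`, `a²c²` are not
integral powers of `q`; here no denominator that occurs in the proof vanishes. -/
def genericParams : Set (ℂ × ℂ × ℂ) :=
  {p | p.1 ≠ 0 ∧ (∀ k : ℕ, 1 - p.1 * p.1 ^ k ≠ 0) ∧ p.2.1 ≠ 0 ∧ p.2.2 ≠ 0 ∧
    OffLattice p.1 (p.2.1 ^ 2) ∧ OffLattice p.1 (p.2.2 ^ 2) ∧ OffLattice p.1 ((p.2.1 * p.2.2) ^ 2)}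

theorem generic_mem_closure (q a c : ℂ) :
    (q, a, c) ∈ closure genericParams := by
  have key (S : Set ℂ) (hS : S.Countable) (U : Set ℂ) (hU : IsOpen U) (x : ℂ) (hx : x ∈ U) :
      ∃ y ∈ U, y ∉ S := by
    obtain ⟨y, hy, hy'⟩ := (hS.dense_compl ℂ).inter_open_nonempty U hU ⟨x, hx⟩
    exact ⟨y, hy, hy'⟩
  have roots (k : ℕ) (hk : 0 < k) (y : ℂ) : {z : ℂ | z ^ k = y}.Countable := by
    refine ((Polynomial.nthRoots k y).toFinset.finite_toSet.subset ?_).countable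
    intro z hz
    simpa [Polynomial.mem_nthRoots hk] using hz
  rw [mem_closure_iff]
  intro o ho hp
  obtain ⟨U, V, hU, hV, hqU, hacV, hUV⟩ := isOpen_prod_iff.1 ho q (a, c) hp
  obtain ⟨V, W, hV, hW, haV, hcW, hVW⟩ := isOpen_prod_iff.1 hV a c hacV
  obtain ⟨q', hq'U, hq'⟩ := key ({0} ∪ ⋃ k : ℕ, {z | z ^ (k + 1) = 1})
    ((Set.countable_singleton _).union (Set.countable_iUnion fun k => roots _ k.succ_pos _))
    U hU q hqU
  obtain ⟨a', ha'V, ha'⟩ := key ({0} ∪ ⋃ e : ℤ, {z | z ^ 2 = q' ^ e})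
    ((Set.countable_singleton _).union (Set.countable_iUnion fun e => roots _ two_pos _))
    V hV a haV
  obtain ⟨c', hc'W, hc'⟩ := key ({0} ∪ ((⋃ e : ℤ, {z | z ^ 2 = q' ^ e}) ∪
      ⋃ e : ℤ, {z | z ^ 2 = q' ^ e / a' ^ 2}))
    ((Set.countable_singleton _).union
      ((Set.countable_iUnion fun e => roots _ two_pos _).union
        (Set.countable_iUnion fun e => roots _ two_pos _)))
    W hW c hcW
  simp only [Set.mem_union, Set.mem_singleton_iff, Set.mem_iUnion, Set.mem_ofPred_eq, not_or,
    not_exists] at hq' ha' hc'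
  refine ⟨(q', a', c'), hUV ⟨hq'U, hVW ⟨ha'V, hc'W⟩⟩, hq'.1, fun k h => hq'.2 k ?_, ha'.1, hc'.1,
    ha'.2, hc'.2.1, fun e h => hc'.2.2 e ?_⟩
  · rw [pow_succ']; exact (sub_eq_zero.1 h).symm
  · have h' : (a' * c') ^ 2 = q' ^ e := h
    have := ha'.1
    rw [← h']; field_simp

@[fun_prop]
theorem ContinuousAt.qPoch {X : Type*} [TopologicalSpace X] {f g : X → ℂ} {x : X}
    (hf : ContinuousAt f x) (hg : ContinuousAt g x) (n : ℕ) :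
    ContinuousAt (fun y => qPoch (f y) (g y) n) x := by
  unfold _root_.qPoch
  fun_prop

theorem qPoch_ne_zero_of_le {x q : ℂ} {k n : ℕ} (h : qPoch x q n ≠ 0) (hk : k ≤ n) :
    qPoch x q k ≠ 0 := by
  obtain ⟨r, rfl⟩ := Nat.exists_eq_add_of_le hk
  rw [qPoch_add] at h
  exact left_ne_zero_of_mul h

theorem basicHypTerm_eq_zero {q : ℂ} (hq0 : q ≠ 0) {n k : ℕ} (h : n < k) (z : ℂ) (as bs : List ℂ) :
    basicHypTerm q z (q ^ (-n : ℤ) :: as) bs k = 0 := by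
  simp only [basicHypTerm, qFrac, List.map_cons, List.prod_cons, qPoch_zpow_neg_eq_zero hq0 h,
    zero_mul, zero_div]

theorem continuousAt_series {q a c : ℂ} (hq0 : q ≠ 0) (ha0 : a ≠ 0) (hc0 : c ≠ 0) {n l m : ℕ}
    (hseries : qDenNonzero q
      [q, q ^ (1 + l - n : ℤ) / a, q ^ (1 - m - n : ℤ) / c, -(a * c)] n) :
    ContinuousAt (fun p : ℂ × ℂ × ℂ => ∑ k ∈ range (n + 1), basicHypTerm p.1 p.1
      [p.1 ^ (-n : ℤ), p.2.1, p.2.2, -p.1 ^ (1 + l - m - n : ℤ) / (p.2.1 * p.2.2)]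
      [p.1 ^ (1 + l - n : ℤ) / p.2.1, p.1 ^ (1 - m - n : ℤ) / p.2.2, -(p.2.1 * p.2.2)] k)
      (q, a, c) := by
  refine tendsto_finsetSum _ fun k hk => ?_
  have hk' : k ≤ n := Nat.lt_succ_iff.1 (mem_range.1 hk)
  simp only [qDenNonzero, List.forall_mem_cons, List.not_mem_nil, false_imp_iff, implies_true,
    and_true] at hseries
  obtain ⟨h1, h2, h3, h4⟩ := hseries
  have h1 := qPoch_ne_zero_of_le h1 hk'
  have h2 := qPoch_ne_zero_of_le h2 hk'
  have h3 := qPoch_ne_zero_of_le h3 hk'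
  have h4 := qPoch_ne_zero_of_le h4 hk'
  simp only [basicHypTerm, qFrac, List.map_cons, List.map_nil, List.prod_cons, List.prod_nil,
    mul_one]
  change ContinuousAt _ _
  fun_prop (disch := dsimp only; first | with_reducible exact Or.inl ‹_› |
    (repeat' first | with_reducible assumption | apply mul_ne_zero))

theorem continuousAt_prefactor {q a c : ℂ} (hq0 : q ≠ 0) (ha0 : a ≠ 0) {n l m : ℕ}
    (hpre₁ : qDenNonzero q [q ^ (1 + l : ℤ) / a ^ 2, -q ^ (1 - n : ℤ) / a] l)
    (hpre₂ : qDenNonzero q [-(a * c), q ^ m * c] n) :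
    ContinuousAt (fun p : ℂ × ℂ × ℂ =>
      qFrac p.1 [p.1 ^ (1 + l - n : ℤ) / p.2.1 ^ 2, -p.1 / p.2.1]
        [p.1 ^ (1 + l : ℤ) / p.2.1 ^ 2, -p.1 ^ (1 - n : ℤ) / p.2.1] l *
      qFrac p.1 [-p.2.1, p.1 ^ m * p.2.2 ^ 2] [-(p.2.1 * p.2.2), p.1 ^ m * p.2.2] n)
      (q, a, c) := by
  simp only [qDenNonzero, List.forall_mem_cons, List.not_mem_nil, false_imp_iff, implies_true,
    and_true] at hpre₁ hpre₂
  obtain ⟨h1, h2⟩ := hpre₁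
  have ha2 : a ^ 2 ≠ 0 := pow_ne_zero 2 ha0
  obtain ⟨h3, h4⟩ := hpre₂
  simp only [qFrac, List.map_cons, List.map_nil, List.prod_cons, List.prod_nil,
    mul_one]
  fun_prop (disch := dsimp only; first | with_reducible exact Or.inl ‹_› |
    (repeat' first | with_reducible assumption | apply mul_ne_zero))

set_option maxHeartbeats 1000000 in
theorem continuousAt_doubleSumTerm {q a c : ℂ} (hq0 : q ≠ 0) (ha0 : a ≠ 0) (hc0 : c ≠ 0)
    {n l m i j : ℕ}
    (h : 1 - q ^ (-2 * l - 1 : ℤ) * a ^ 2 ≠ 0 ∧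
      qDenNonzero q [q, q ^ (n - 2 * l : ℤ) * a ^ 2, q ^ (-l : ℤ) * a ^ 2] i ∧
      qDenNonzero q
        [q, q ^ (1 + l - n : ℤ) / a, -q ^ (1 + l - n : ℤ) / a,
          q ^ m * c ^ 2, q ^ (j - 1 : ℤ) * c ^ 2] j ∧
      qDenNonzero (q ^ 2)
        [q ^ (2 + 2 * l - 2 * n + 2 * j : ℤ) / a ^ 2, q ^ (1 + 2 * j) * c ^ 2]
        ((n - i - j) / 2)) :
    ContinuousAt (fun p : ℂ × ℂ × ℂ => doubleSumTerm p.1 p.2.1 p.2.2 n l m i j) (q, a, c) := by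
  simp only [qDenNonzero, List.forall_mem_cons, List.not_mem_nil, false_imp_iff, implies_true,
    and_true] at h
  have ha2 : a ^ 2 ≠ 0 := pow_ne_zero 2 ha0
  have hc2 : c ^ 2 ≠ 0 := pow_ne_zero 2 hc0
  obtain ⟨h1, ⟨h2, h3, h4⟩, ⟨h5, h6, h7, h8, h9⟩, h10, h11⟩ := h
  simp only [doubleSumTerm, qFrac, List.map_cons, List.map_nil, List.prod_cons, List.prod_nil,
    mul_one]
  refine (((ContinuousAt.mul ?_ ?_).mul ?_).mul ?_).mul ?_ <;>
  fun_prop (disch := dsimp only; first | with_reducible exact Or.inl ‹_› |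
    (repeat' first | with_reducible assumption | apply mul_ne_zero))

theorem theorem5 (q a c : ℂ) (n ℓ m : ℕ)
    (hq : q ≠ 0) (ha : a ≠ 0) (hc : c ≠ 0)
    -- no zero factor in a denominator of the series on the left (terms `k ≤ n`)
    (hseries : qDenNonzero q
      [q, q ^ (1 + ℓ - n : ℤ) / a, q ^ (1 - m - n : ℤ) / c, -(a * c)] n)
    -- no zero factor in a denominator of the two prefactors on the right
    (hpre₁ : qDenNonzero q [q ^ (1 + ℓ : ℤ) / a ^ 2, -q ^ (1 - n : ℤ) / a] ℓ)
    (hpre₂ : qDenNonzero q [-(a * c), q ^ m * c] n)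
    -- no zero factor in a denominator of a term of the double sum with `n - i - j` even and `≥ 0`
    (hsum : ∀ i ≤ ℓ, ∀ j ≤ m, i + j ≤ n → Even (n - i - j) →
      1 - q ^ (-2 * ℓ - 1 : ℤ) * a ^ 2 ≠ 0 ∧
      qDenNonzero q [q, q ^ (n - 2 * ℓ : ℤ) * a ^ 2, q ^ (-ℓ : ℤ) * a ^ 2] i ∧
      qDenNonzero q
        [q, q ^ (1 + ℓ - n : ℤ) / a, -q ^ (1 + ℓ - n : ℤ) / a,
          q ^ m * c ^ 2, q ^ (j - 1 : ℤ) * c ^ 2] j ∧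
      qDenNonzero (q ^ 2)
        [q ^ (2 + 2 * ℓ - 2 * n + 2 * j : ℤ) / a ^ 2, q ^ (1 + 2 * j) * c ^ 2]
        ((n - i - j) / 2)) :
    Summable (basicHypTerm q q
      [q ^ (-n : ℤ), a, c, -q ^ (1 + ℓ - m - n : ℤ) / (a * c)]
      [q ^ (1 + ℓ - n : ℤ) / a, q ^ (1 - m - n : ℤ) / c, -(a * c)]) ∧
    basicHyp q q
      [q ^ (-n : ℤ), a, c, -q ^ (1 + ℓ - m - n : ℤ) / (a * c)]
      [q ^ (1 + ℓ - n : ℤ) / a, q ^ (1 - m - n : ℤ) / c, -(a * c)] =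
    qFrac q [q ^ (1 + ℓ - n : ℤ) / a ^ 2, -q / a]
        [q ^ (1 + ℓ : ℤ) / a ^ 2, -q ^ (1 - n : ℤ) / a] ℓ *
      qFrac q [-a, q ^ m * c ^ 2] [-(a * c), q ^ m * c] n *
      ∑ i ∈ range (ℓ + 1), ∑ j ∈ range (m + 1),
        (-1) ^ i * q ^ (n * i + (m + n - i) * j - (j.choose 2 : ℕ) : ℤ) *
          a ^ i * c ^ (n - i : ℤ) *
          ((1 - q ^ (2 * i - 2 * ℓ - 1 : ℤ) * a ^ 2) / (1 - q ^ (-2 * ℓ - 1 : ℤ) * a ^ 2)) *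
          qFrac q [q ^ (-ℓ : ℤ), q ^ (-n : ℤ), q ^ (-2 * ℓ - 1 : ℤ) * a ^ 2]
            [q, q ^ (n - 2 * ℓ : ℤ) * a ^ 2, q ^ (-ℓ : ℤ) * a ^ 2] i *
          qFrac q
            [q ^ (-m : ℤ), q ^ (i - n : ℤ), q ^ (1 + 2 * ℓ - n - i : ℤ) / a ^ 2, c, -c]
            [q, q ^ (1 + ℓ - n : ℤ) / a, -q ^ (1 + ℓ - n : ℤ) / a,
              q ^ m * c ^ 2, q ^ (j - 1 : ℤ) * c ^ 2] j *
          -- where the natural-number subtraction truncates (`n < i + j`), the factor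
          -- `(q^{-n}; q)_i` or `(q^{i-n}; q)_j` makes the term zero
          qFrac (q ^ 2)
            [q, q ^ (2 + 2 * ℓ - 2 * n : ℤ) / (a ^ 2 * c ^ 2)]
            [q ^ (2 + 2 * ℓ - 2 * n + 2 * j : ℤ) / a ^ 2, q ^ (1 + 2 * j) * c ^ 2]
            ((n - i - j) / 2) *
          chi (n - i - j) := by
  have hsupp : ∀ k ∉ range (n + 1), basicHypTerm q q
      [q ^ (-n : ℤ), a, c, -q ^ (1 + ℓ - m - n : ℤ) / (a * c)]
      [q ^ (1 + ℓ - n : ℤ) / a, q ^ (1 - m - n : ℤ) / c, -(a * c)] k = 0 := fun k hk =>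
    basicHypTerm_eq_zero hq (by simpa using hk) _ _ _
  refine ⟨(hasSum_sum_of_ne_finset_zero hsupp).summable, ?_⟩
  rw [basicHyp, tsum_eq_sum hsupp]
  have hsum' : ContinuousAt (fun p : ℂ × ℂ × ℂ => ∑ i ∈ range (ℓ + 1), ∑ j ∈ range (m + 1),
      doubleSumTerm p.1 p.2.1 p.2.2 n ℓ m i j * chi (n - i - j)) (q, a, c) := by
    refine tendsto_finsetSum _ fun i hi => tendsto_finsetSum _ fun j hj => ?_
    change ContinuousAt (fun p : ℂ × ℂ × ℂ => _) _
    by_cases hij : i + j ≤ n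
    · obtain ⟨k, hk⟩ := Nat.exists_eq_add_of_le hij
      have e : (n - i - j : ℤ) = k := by omega
      obtain ⟨h, hh | hh⟩ := Nat.even_or_odd' k
      · refine (continuousAt_doubleSumTerm hq ha hc ?_).mul continuousAt_const
        exact hsum i (Nat.lt_succ_iff.1 (mem_range.1 hi)) j (Nat.lt_succ_iff.1 (mem_range.1 hj)) hij
          ⟨h, by omega⟩
      · rw [e, hh, chi_odd]
        simpa only [mul_zero] using continuousAt_const
    -- Denominators of these terms may vanish, but the terms are identically zero near the point.
    · refine (continuousAt_const (y := (0 : ℂ))).congr ?_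
      have hne : ∀ᶠ p : ℂ × ℂ × ℂ in 𝓝 (q, a, c), p.1 ≠ 0 :=
        continuousAt_fst.eventually_ne hq
      filter_upwards [hne] with p hp
      rw [doubleSumTerm_eq_zero hp _ _ (by omega), zero_mul]
  have hF := continuousAt_series hq ha hc hseries
  have hG := (continuousAt_prefactor hq ha hpre₁ hpre₂).mul hsum'
  have : (𝓝[genericParams] (q, a, c)).NeBot :=
    mem_closure_iff_nhdsWithin_neBot.1 (generic_mem_closure q a c)
  refine tendsto_nhds_unique (l := 𝓝[genericParams] (q, a, c)) (hF.mono_left nhdsWithin_le_nhds)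
    ((hG.mono_left nhdsWithin_le_nhds).congr' ?_)
  filter_upwards [self_mem_nhdsWithin] with p hp
  obtain ⟨h1, h2, h3, h4, h5, h6, h7⟩ := hp
  exact (series_eq_of_generic h1 h2 h3 h4 h5 h6 h7 n ℓ m).symm
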